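/- Let $G=(V,E)$ be a countably infinite simple graph. For $p\in[0,1]$ let $\Pr_p$ be the law of Bernoulli bond percolation on $G$ (each edge is occupied with probability $p$ and vacant with probability $1-p$, independently). For $o\in V$ let $C(o)$ be the cluster of $o$, that is, the component of $o$ in the subgraph formed by the occupied edges, and let $\theta_o(p)=\Pr_p(|C(o)|=\infty)$. Let $$p_{\mathbb C}=\inf\{p\in[0,1] : \theta_o \text{ is real-analytic in } (p,1]\},$$ $$p_u=\inf\{p\in[0,1] : \Pr_p\text{-almost surely there is exactly one infinite cluster}\},$$ $$h_E(G)=\inf_S \frac{|\partial_E S|}{|S|},$$ where $S$ ranges over the nonempty finite sets of vertices and $\partial_E S$ is the set of edges with exactly one end-vertex in $S$. Analyticity of $\theta_o$ on a subset $I$ of $[0,1]$ means that near each point $x\in I$ the function $\theta_o$ agrees on $I$ with a power series centred at $x$ with positive radius of convergence (so it is one-sided at $x=1$). **Theorem.** 1. If $G$ has bounded degrees and $h:=h_E(G)>0$, then for every $o\in V$ the function $\theta_o$ is analytic on $\left(\frac1{1+h},1\right]$, and hence $p_{\mathbb C}\le \frac1{1+h}$. 2. Every finitely generated non-amenable group $\Gamma$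 (that is, one without a left-invariant finitely additive probability measure defined on all its subsets) has a finite generating set $S$ such that, for the simple Cayley graph $G$ of $\Gamma$ with respect to $S$ (in which $g\neq g'$ are adjacent if and only if $g^{-1}g'\in S\cup S^{-1}$), the function $\theta_o$, as a function on $[0,1]$, is analytic at $p_u(G)$ for every vertex $o$. -/

import Mathlib

open MeasureTheory Set
open scoped ENNReal Pointwise

/-! ## The edge Cheeger constant -/

namespace SimpleGraph

variable {V : Type*}

/-- Degrees are bounded by a common finite constant. -/
def BoundedDegree (G : SimpleGraph V) : Prop :=
  ∃ d : ℕ, ∀ v : V, (G.neighborSet v).encard ≤ d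

/-- The edges of `G` with exactly one end-vertex in `S`. -/
def edgeBoundary (G : SimpleGraph V) (S : Set V) : Set (Sym2 V) :=
  {e | ∃ x ∈ S, ∃ y ∉ S, G.Adj x y ∧ e = s(x, y)}

/-- The edge Cheeger constant: the infimum of `|∂S| / |S|` over the nonempty finite vertex
sets `S` (used for locally finite graphs, where all edge boundaries are finite). -/
noncomputable def edgeCheeger (G : SimpleGraph V) : ℝ :=
  ⨅ S : {S : Finset V // S.Nonempty}, ((G.edgeBoundary (S : Finset V)).ncard : ℝ) / (S.1.card : ℝ)

/-! ## Bernoulli bond percolation -/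

/-- Percolation instances; an edge `e` is occupied in `ω` if `ω e = true`. -/
abbrev PercInstance (G : SimpleGraph V) : Type _ := G.edgeSet → Bool

/-- Bernoulli bond percolation: the product over all edges of the measures that give mass `p` to
`true` (occupied) and `1 - p` to `false` (vacant). -/
noncomputable def bondPerc (G : SimpleGraph V) (p : unitInterval) : Measure G.PercInstance :=
  Measure.infinitePi fun _ : G.edgeSet => ProbabilityTheory.bernoulliMeasure true false p

/-- The spanning subgraph of `G` formed by the occupied edges. -/
def occupied (G : SimpleGraph V) (ω : G.PercInstance) : SimpleGraph V where
  Adj x y := ∃ h : G.Adj x y, ω ⟨s(x, y), h⟩ = true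
  symm := ⟨by
    rintro x y ⟨h, hω⟩
    refine ⟨h.symm, ?_⟩
    have : (⟨s(y, x), h.symm⟩ : G.edgeSet) = ⟨s(x, y), h⟩ := Subtype.ext Sym2.eq_swap
    rw [this, hω]⟩
  loopless := ⟨fun x hx => G.loopless.irrefl x hx.1⟩

/-- The cluster `C(o)`: the vertex set of the component of `o` in the occupied subgraph. -/
def cluster (G : SimpleGraph V) (ω : G.PercInstance) (o : V) : Set V :=
  {v | (G.occupied ω).Reachable o v}

/-- The percolation density `θ_o(p)`, the probability that `C(o)` is infinite. It is defined for
`p ∈ [0, 1]`; to have a function on `ℝ`, it is extended by constants outside of `[0, 1]`, and every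
use below looks only at its values on `[0, 1]`. -/
noncomputable def percDensity (G : SimpleGraph V) (o : V) : ℝ → ℝ :=
  IccExtend zero_le_one fun p : unitInterval => (G.bondPerc p).real {ω | (G.cluster ω o).Infinite}

/-- The threshold `p_ℂ`: the infimum of the `p ∈ [0, 1]` such that `θ_o` is analytic in `(p, 1]`.
(`AnalyticOn ℝ f s` means that at every point of `s`, the function `f` is given on `s`,
near that point, by a power series with positive radius of convergence.) -/
noncomputable def pAnalytic (G : SimpleGraph V) (o : V) : ℝ :=
  sInf {p : ℝ | p ∈ Icc (0 : ℝ) 1 ∧ AnalyticOn ℝ (G.percDensity o) (Ioc p 1)}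

/-- There is exactly one infinite cluster. -/
def UniqueInfiniteCluster (G : SimpleGraph V) (ω : G.PercInstance) : Prop :=
  ∃! C : (G.occupied ω).ConnectedComponent, C.supp.Infinite

/-- The uniqueness threshold `p_u`: the infimum of the `p ∈ [0, 1]` for which there is almost
surely exactly one infinite cluster. -/
noncomputable def pUnique (G : SimpleGraph V) : ℝ :=
  sInf {p : ℝ | ∃ hp : p ∈ Icc (0 : ℝ) 1, ∀ᵐ ω ∂(G.bondPerc ⟨p, hp⟩), G.UniqueInfiniteCluster ω}

end SimpleGraph

/-- A (discrete) group is amenable if it has a left-invariant finitely additive probability measure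
defined on all its subsets. -/
def AmenableGroup (Γ : Type*) [Group Γ] : Prop :=
  ∃ m : Set Γ → ℝ≥0∞, m univ = 1 ∧ (∀ s t : Set Γ, Disjoint s t → m (s ∪ t) = m s + m t) ∧
    ∀ (g : Γ) (s : Set Γ), m (g • s) = m s

/-! Part 1. Explore the cluster of `o` edge by edge. If it is finite, the exploration stops with `a`
edges found occupied and `b` found vacant. The occupied ones form a spanning tree of the cluster,
and the vacant ones include its whole edge boundary, so `b ≥ h(a + 1) ≥ ha`. The outcomes are
disjoint cylinder events, whence `1 - θ_o(p) = ∑ p^a (1-p)^b`. At `q = 1/(1+h)` this sum is a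
probability, so it converges. Since `t(1-t)^h` has its strict maximum over `[0,1]` at `q`, the
complex `z` with `‖z‖ > q` and `‖z‖‖1-z‖^h < q(1-q)^h` form an open set containing `(q,1]`. There `b
≥ ha` bounds each term by its value at `q`, and the Weierstrass M-test makes the sum holomorphic
(`analyticAt_tsum_pow_mul_pow`).

Part 2. Let `c` be the norm of `T_S = ∑_{s ∈ S} ρ(s)` on `ℓ²(Γ)`, where `ρ` is the right regular
representation. Testing `T_S` on indicators gives `h ≥ |S| - c`. There are at most `c^n` walks of
length `n` between two given vertices, so for `pc < 1` connection probabilities decay, which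
excludes uniqueness: `p_u ≥ 1/c`. If `2c ≤ |S|`, then `h ≥ c` and `1/(1+h) < 1/c ≤ p_u`, so Part 1
applies at `p_u`.

Such an `S` exists: by Kesten's criterion some symmetric generating set `S₀` has norm less than
`|S₀|`. Passing to a level set of a high convolution power makes the ratio of norm to size
arbitrarily small, and adding `S₀` back to generate costs little. -/

/-! ## The right regular representation on `ℓ²` -/

section RegularRepresentation

variable {Γ : Type*}

/-- The real Hilbert space `ℓ²(Γ)`. -/
abbrev L2 (Γ : Type*) : Type _ := lp (fun _ : Γ => ℝ) 2

namespace L2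

lemma norm_sq_eq_tsum (f : L2 Γ) : ‖f‖ ^ 2 = ∑' x, f x ^ 2 := by
  rw [← real_inner_self_eq_norm_sq, lp.inner_eq_tsum]
  exact tsum_congr fun x => by simp [sq]

lemma summable_sq (f : L2 Γ) : Summable fun x => f x ^ 2 := by
  have := lp.summable_inner (𝕜 := ℝ) f f
  refine this.congr fun x => by simp [sq]

lemma memℓp_of_summable_sq {f : Γ → ℝ} (h : Summable fun x => f x ^ 2) : Memℓp f 2 := by
  refine memℓp_gen ?_
  simpa using h

lemma norm_le_norm_of_abs_le {f g : L2 Γ} (h : ∀ x, |f x| ≤ |g x|) : ‖f‖ ≤ ‖g‖ := by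
  refine le_of_sq_le_sq ?_ (norm_nonneg _)
  rw [norm_sq_eq_tsum, norm_sq_eq_tsum]
  exact (summable_sq f).tsum_le_tsum (fun x => sq_le_sq.mpr (h x)) (summable_sq g)

/-- The pointwise absolute value. -/
noncomputable def abs (f : L2 Γ) : L2 Γ :=
  ⟨fun x => |f x|, memℓp_of_summable_sq (by simpa using summable_sq f)⟩

@[simp] lemma abs_apply (f : L2 Γ) (x : Γ) : L2.abs f x = |f x| := rfl

@[simp] lemma norm_abs (f : L2 Γ) : ‖L2.abs f‖ = ‖f‖ :=
  le_antisymm (norm_le_norm_of_abs_le (by simp)) (norm_le_norm_of_abs_le (by simp))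

variable [Group Γ]

/-- The right translation `f ↦ f (· * g)` as a linear isometry of `ℓ²(Γ)`. -/
noncomputable def rightTranslation (g : Γ) : L2 Γ →ₗᵢ[ℝ] L2 Γ where
  toFun f := ⟨fun x => f (x * g),
    memℓp_of_summable_sq ((Equiv.mulRight g).summable_iff.mpr (summable_sq f))⟩
  map_add' _ _ := rfl
  map_smul' _ _ := rfl
  norm_map' f := by
    refine (sq_eq_sq₀ (norm_nonneg _) (norm_nonneg _)).mp ?_
    rw [norm_sq_eq_tsum, norm_sq_eq_tsum]
    exact (Equiv.mulRight g).tsum_eq (fun x => f x ^ 2)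

@[simp] lemma rightTranslation_apply (g : Γ) (f : L2 Γ) (x : Γ) :
    rightTranslation g f x = f (x * g) := rfl

/-- The right regular representation of `Γ`. -/
noncomputable def rightRegular : Γ →* (L2 Γ →L[ℝ] L2 Γ) where
  toFun g := (rightTranslation g).toContinuousLinearMap
  map_one' := by
    ext f x
    exact congrArg f (mul_one x)
  map_mul' g h := by
    ext f x
    exact congrArg f (mul_assoc x g h).symm

@[simp] lemma rightRegular_apply (g : Γ) (f : L2 Γ) (x : Γ) :
    rightRegular g f x = f (x * g) := rfl

@[simp] lemma norm_rightRegular_apply (g : Γ) (f : L2 Γ) : ‖rightRegular g f‖ = ‖f‖ :=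
  (rightTranslation g).norm_map f

lemma norm_rightRegular_le (g : Γ) : ‖rightRegular g‖ ≤ 1 :=
  (rightTranslation g).norm_toContinuousLinearMap_le

/-- The convolution operators of the elements of the semigroup ring `ℕ[Γ]`. -/
noncomputable def convOp : MonoidAlgebra ℕ Γ →ₐ[ℕ] (L2 Γ →L[ℝ] L2 Γ) :=
  MonoidAlgebra.lift ℕ (L2 Γ →L[ℝ] L2 Γ) Γ rightRegular

lemma convOp_apply (b : MonoidAlgebra ℕ Γ) (f : L2 Γ) (x : Γ) :
    convOp b f x = ∑ g ∈ b.coeff.support, (b.coeff g : ℝ) * f (x * g) := by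
  have h1 : convOp b = ∑ g ∈ b.coeff.support, b.coeff g • rightRegular g :=
    MonoidAlgebra.lift_apply _ _
  rw [h1, _root_.sum_apply, lp.coeFn_sum, Finset.sum_apply]
  refine Finset.sum_congr rfl fun g _ => ?_
  simp

lemma convOp_apply_of_subset {b : MonoidAlgebra ℕ Γ} {s : Finset Γ} (hs : b.coeff.support ⊆ s)
    (f : L2 Γ) (x : Γ) :
    convOp b f x = ∑ g ∈ s, (b.coeff g : ℝ) * f (x * g) := by
  rw [convOp_apply]
  exact Finset.sum_subset hs fun g _ hg => by simp [Finsupp.notMem_support_iff.mp hg]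

lemma abs_convOp_apply_le {b c : MonoidAlgebra ℕ Γ} (hbc : ∀ g, b.coeff g ≤ c.coeff g) (f : L2 Γ)
    (x : Γ) : |convOp b f x| ≤ convOp c (L2.abs f) x := by
  have hsub : b.coeff.support ⊆ c.coeff.support := by
    intro g hg
    rw [Finsupp.mem_support_iff] at hg ⊢
    have := hbc g
    omega
  rw [convOp_apply_of_subset hsub, convOp_apply]
  refine (Finset.abs_sum_le_sum_abs _ _).trans (Finset.sum_le_sum fun g _ => ?_)
  rw [abs_mul, Nat.abs_cast, abs_apply]
  gcongr
  exact hbc g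

lemma norm_convOp_apply_le {b c : MonoidAlgebra ℕ Γ} (hbc : ∀ g, b.coeff g ≤ c.coeff g)
    (f : L2 Γ) : ‖convOp b f‖ ≤ ‖convOp c (L2.abs f)‖ :=
  norm_le_norm_of_abs_le fun x => (abs_convOp_apply_le hbc f x).trans (le_abs_self _)

/-- Nonnegative coefficients make these operators positive, so it suffices to compare them on
absolute values of functions. -/
lemma norm_convOp_mono {b c : MonoidAlgebra ℕ Γ} (hbc : ∀ g, b.coeff g ≤ c.coeff g) :
    ‖convOp b‖ ≤ ‖convOp c‖ := by
  refine ContinuousLinearMap.opNorm_le_bound _ (norm_nonneg _) fun f => ?_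
  refine (norm_convOp_apply_le hbc f).trans ?_
  rw [← norm_abs f]
  exact ContinuousLinearMap.le_opNorm _ _

/-- The coefficients of `b` are the values of `convOp b` applied to the unit vector concentrated at
`1`. -/
lemma coeff_le_norm_convOp (b : MonoidAlgebra ℕ Γ) (g : Γ) : (b.coeff g : ℝ) ≤ ‖convOp b‖ := by
  classical
  set δ : L2 Γ := lp.single 2 1 (1 : ℝ) with hδ
  have hδn : ‖δ‖ = 1 := by rw [hδ, lp.norm_single (by norm_num)]; simp
  have h1 : convOp b δ g⁻¹ = b.coeff g := by
    rw [convOp_apply_of_subset (Finset.subset_insert g _),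
      Finset.sum_eq_single_of_mem g (Finset.mem_insert_self _ _)]
    · simp [hδ]
    · intro h _ hne
      have : g⁻¹ * h ≠ 1 := fun hc => hne (inv_mul_eq_one.mp hc).symm
      simp [hδ, this]
  calc (b.coeff g : ℝ) ≤ ‖convOp b δ g⁻¹‖ := by rw [h1]; exact le_abs_self _
    _ ≤ ‖convOp b δ‖ := lp.norm_apply_le_norm (by norm_num) _ _
    _ ≤ ‖convOp b‖ * ‖δ‖ := ContinuousLinearMap.le_opNorm _ _
    _ = ‖convOp b‖ := by rw [hδn, mul_one]

end L2

/-- The sum in `ℕ[Γ]` of the elements of a finite subset of `Γ`. -/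
noncomputable def Finset.toMonoidAlgebra (S : Finset Γ) : MonoidAlgebra ℕ Γ :=
  ∑ s ∈ S, MonoidAlgebra.single s 1

open Classical in
lemma Finset.coeff_toMonoidAlgebra (S : Finset Γ) (g : Γ) :
    S.toMonoidAlgebra.coeff g = if g ∈ S then 1 else 0 := by
  simp [Finset.toMonoidAlgebra, Finsupp.single_apply]

lemma Finset.coeff_toMonoidAlgebra_mul [Group Γ] (S : Finset Γ) (b : MonoidAlgebra ℕ Γ) (g : Γ) :
    (S.toMonoidAlgebra * b).coeff g = ∑ s ∈ S, b.coeff (s⁻¹ * g) := by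
  rw [Finset.toMonoidAlgebra, Finset.sum_mul]
  simp

lemma Finset.coeff_mul_toMonoidAlgebra [Group Γ] (S : Finset Γ) (b : MonoidAlgebra ℕ Γ) (g : Γ) :
    (b * S.toMonoidAlgebra).coeff g = ∑ s ∈ S, b.coeff (g * s⁻¹) := by
  rw [Finset.toMonoidAlgebra, Finset.mul_sum]
  simp

lemma L2.convOp_toMonoidAlgebra [Group Γ] (S : Finset Γ) :
    L2.convOp S.toMonoidAlgebra = ∑ s ∈ S, L2.rightRegular s := by
  rw [Finset.toMonoidAlgebra, map_sum]
  exact Finset.sum_congr rfl fun s _ => by simp [L2.convOp]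

lemma L2.norm_convOp_toMonoidAlgebra_le [Group Γ] (S : Finset Γ) :
    ‖L2.convOp S.toMonoidAlgebra‖ ≤ S.card := by
  rw [L2.convOp_toMonoidAlgebra]
  refine (norm_sum_le _ _).trans ?_
  refine (Finset.sum_le_sum fun s _ => L2.norm_rightRegular_le s).trans ?_
  simp

end RegularRepresentation

/-! ### Kesten's criterion: an averaging operator of full norm yields an invariant mean -/

section Kesten

open Filter Topology

variable {Γ : Type*}

namespace L2

/-- Factor `v² - u² = (v - u)(v + u)` and apply Cauchy–Schwarz. -/
lemma abs_tsum_mul_sq_sub_le {φ : Γ → ℝ} (hφ : ∀ x, |φ x| ≤ 1) (u v : L2 Γ) :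
    |∑' x, φ x * (v x ^ 2 - u x ^ 2)| ≤ ‖v - u‖ * ‖v + u‖ := by
  have e : (fun x => |v x - u x| * |v x + u x|)
      = fun x => inner ℝ (L2.abs (v - u) x) (L2.abs (v + u) x) := by
    funext x
    simp [mul_comm]
  have hs : HasSum (fun x => |v x - u x| * |v x + u x|)
      (inner ℝ (L2.abs (v - u)) (L2.abs (v + u))) := by
    rw [e]
    exact lp.hasSum_inner _ _
  have hle : ∀ x, ‖φ x * (v x ^ 2 - u x ^ 2)‖ ≤ |v x - u x| * |v x + u x| := by
    intro x
    rw [norm_mul, Real.norm_eq_abs, Real.norm_eq_abs, ← abs_mul (v x - u x)]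
    refine (mul_le_of_le_one_left (abs_nonneg _) (hφ x)).trans (le_of_eq ?_)
    congr 1; ring
  rw [← Real.norm_eq_abs]
  refine (tsum_of_norm_bounded hs hle).trans ((real_inner_le_norm _ _).trans ?_)
  rw [norm_abs, norm_abs]

lemma indicator_mem_Icc (A : Set Γ) (x : Γ) : (A.indicator 1 x : ℝ) ∈ Icc (0 : ℝ) 1 := by
  by_cases h : x ∈ A <;> simp [h]

variable [Group Γ]

/-- If the sum of `|S|` unit vectors has norm almost `|S|`, any two of them have a sum of norm
almost `2`, and by the parallelogram law they almost coincide. As `1 ∈ S`, the vector `u` itself is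
one of them. -/
lemma exists_almost_invariant {S : Finset Γ} (h1 : 1 ∈ S)
    (hS : (S.card : ℝ) ≤ ‖convOp S.toMonoidAlgebra‖) {ε : ℝ} (hε : 0 < ε) :
    ∃ f : L2 Γ, ‖f‖ = 1 ∧ ∀ s ∈ S, ‖rightRegular s f - f‖ ≤ ε := by
  classical
  -- The parallelogram law will give a squared distance of at most `4 - (2 - δ)² ≤ 4δ ≤ ε²`; the
  -- bound `1/2` keeps `|S| - δ` nonnegative.
  set δ : ℝ := min (ε ^ 2 / 4) (1 / 2) with hδ
  have hδ0 : 0 < δ := by positivity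
  have hcard : (1 : ℝ) ≤ S.card := by exact_mod_cast Finset.card_pos.mpr ⟨1, h1⟩
  have hδ1 : δ ≤ 1 / 2 := min_le_right _ _
  obtain ⟨f, hf⟩ : ∃ f : L2 Γ, (S.card - δ) * ‖f‖ < ‖convOp S.toMonoidAlgebra f‖ := by
    by_contra! hc
    have := ContinuousLinearMap.opNorm_le_bound _ (by linarith) hc
    linarith
  have hf0 : f ≠ 0 := by rintro rfl; simp at hf
  have hfn : 0 < ‖f‖ := norm_pos_iff.mpr hf0
  set u : L2 Γ := ‖f‖⁻¹ • f with hu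
  have hun : ‖u‖ = 1 := by rw [hu, norm_smul, norm_inv, norm_norm, inv_mul_cancel₀ hfn.ne']
  have hTu : S.card - δ < ‖convOp S.toMonoidAlgebra u‖ := by
    rw [hu, map_smul, norm_smul, norm_inv, norm_norm, inv_mul_eq_div, lt_div_iff₀ hfn]
    exact hf
  refine ⟨u, hun, fun s hs => ?_⟩
  by_cases hs1 : s = 1
  · subst hs1
    simp [hε.le]
  have hsum : convOp S.toMonoidAlgebra u
      = (rightRegular s u + u) + ∑ t ∈ (S.erase 1).erase s, rightRegular t u := by
    have hu1 : u = rightRegular (1 : Γ) u := by simp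
    rw [convOp_toMonoidAlgebra, _root_.sum_apply, ← Finset.add_sum_erase S _ h1,
      ← Finset.add_sum_erase (S.erase 1) _ (Finset.mem_erase.mpr ⟨hs1, hs⟩), ← hu1]
    abel
  have hle : ‖convOp S.toMonoidAlgebra u‖ ≤ ‖rightRegular s u + u‖ + (S.card - 2) := by
    rw [hsum]
    refine (norm_add_le _ _).trans (add_le_add_right ((norm_sum_le _ _).trans ?_) _)
    have hc2 : ((S.erase 1).erase s).card + 2 = S.card := by
      have e1 := Finset.card_erase_add_one h1
      have e2 := Finset.card_erase_add_one (Finset.mem_erase.mpr ⟨hs1, hs⟩)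
      omega
    simp only [norm_rightRegular_apply, hun, Finset.sum_const, nsmul_eq_mul, mul_one]
    rw [← hc2]; push_cast; linarith
  have hpar := parallelogram_law_with_norm ℝ (rightRegular s u) u
  rw [norm_rightRegular_apply, hun] at hpar
  have h2 : 2 - δ ≤ ‖rightRegular s u + u‖ := by linarith
  have h3 : δ ≤ ε ^ 2 / 4 := min_le_left _ _
  refine le_of_sq_le_sq ?_ hε.le
  nlinarith

/-- The mass that `f ^ 2` gives to the inverse of a set. -/
noncomputable def mass (f : L2 Γ) (A : Set Γ) : ℝ :=
  ∑' x, (A.indicator 1 x⁻¹ : ℝ) * f x ^ 2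

lemma summable_mass (f : L2 Γ) (A : Set Γ) :
    Summable fun x => (A.indicator 1 x⁻¹ : ℝ) * f x ^ 2 :=
  (summable_sq f).of_nonneg_of_le
    (fun _ => mul_nonneg (indicator_mem_Icc A _).1 (sq_nonneg _))
    (fun _ => mul_le_of_le_one_left (sq_nonneg _) (indicator_mem_Icc A _).2)

lemma mass_mem_Icc {f : L2 Γ} (hf : ‖f‖ = 1) (A : Set Γ) : mass f A ∈ Icc (0 : ℝ) 1 := by
  refine ⟨tsum_nonneg fun _ => mul_nonneg (indicator_mem_Icc A _).1 (sq_nonneg _), ?_⟩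
  have : (1 : ℝ) = ∑' x, f x ^ 2 := by rw [← norm_sq_eq_tsum, hf, one_pow]
  rw [this]
  exact (summable_mass f A).tsum_le_tsum
    (fun _ => mul_le_of_le_one_left (sq_nonneg _) (indicator_mem_Icc A _).2) (summable_sq f)

lemma mass_univ {f : L2 Γ} (hf : ‖f‖ = 1) : mass f univ = 1 := by
  simp [mass, ← norm_sq_eq_tsum, hf]

lemma mass_union (f : L2 Γ) {A B : Set Γ} (h : Disjoint A B) :
    mass f (A ∪ B) = mass f A + mass f B := by
  rw [mass, mass, mass, ← (summable_mass f A).tsum_add (summable_mass f B)]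
  refine tsum_congr fun x => ?_
  rw [indicator_union_of_disjoint h, add_mul]

lemma abs_mass_smul_sub_le {f : L2 Γ} (hf : ‖f‖ = 1) (g : Γ) (A : Set Γ) :
    |mass f (g • A) - mass f A| ≤ 2 * ‖rightRegular g f - f‖ := by
  -- The inverse in `mass` converts left translation of the set into right translation of `f`.
  have hmem : ∀ x : Γ, ((g • A).indicator 1 x⁻¹ : ℝ) = A.indicator 1 (x * g)⁻¹ := by
    intro x
    have : x⁻¹ ∈ g • A ↔ (x * g)⁻¹ ∈ A := by
      rw [mem_smul_set_iff_inv_smul_mem, smul_eq_mul, mul_inv_rev]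
    by_cases h : (x * g)⁻¹ ∈ A
    · rw [indicator_of_mem (this.mpr h), indicator_of_mem h]; rfl
    · rw [indicator_of_notMem (fun hc => h (this.mp hc)), indicator_of_notMem h]
  have h1 : mass f A = ∑' x, (A.indicator 1 (x * g)⁻¹ : ℝ) * f (x * g) ^ 2 :=
    ((Equiv.mulRight g).tsum_eq (fun x => (A.indicator 1 x⁻¹ : ℝ) * f x ^ 2)).symm
  have s1 : Summable fun x => (A.indicator 1 (x * g)⁻¹ : ℝ) * f (x * g) ^ 2 :=
    (Equiv.mulRight g).summable_iff (f := fun x => (A.indicator 1 x⁻¹ : ℝ) * f x ^ 2)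
      |>.mpr (summable_mass f A)
  have h2 : mass f (g • A) = ∑' x, (A.indicator 1 (x * g)⁻¹ : ℝ) * f x ^ 2 :=
    tsum_congr fun x => by rw [hmem]
  have s2 : Summable fun x => (A.indicator 1 (x * g)⁻¹ : ℝ) * f x ^ 2 :=
    (summable_mass f (g • A)).congr fun x => by rw [hmem]
  have h3 : mass f (g • A) - mass f A
      = ∑' x, (A.indicator 1 (x * g)⁻¹ : ℝ) * (f x ^ 2 - f (x * g) ^ 2) := by
    rw [h1, h2, ← s2.tsum_sub s1]
    exact tsum_congr fun x => by ring
  have hφ : ∀ x : Γ, |(A.indicator 1 (x * g)⁻¹ : ℝ)| ≤ 1 := fun x => by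
    have := indicator_mem_Icc A (x * g)⁻¹
    rw [abs_of_nonneg this.1]
    exact this.2
  have h4 : |mass f (g • A) - mass f A|
      ≤ ‖f - rightRegular g f‖ * ‖f + rightRegular g f‖ := by
    rw [h3]
    exact abs_tsum_mul_sq_sub_le (φ := fun x => A.indicator 1 (x * g)⁻¹) hφ (rightRegular g f) f
  refine h4.trans ?_
  rw [norm_sub_rev, mul_comm]
  gcongr
  refine (norm_add_le _ _).trans ?_
  rw [norm_rightRegular_apply, hf]
  norm_num

end L2

variable [Group Γ]

/-- Kesten's criterion: the averaging operator of a generating set containing `1` has norm less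
than `1` in a non-amenable group. -/
theorem norm_convOp_lt_of_not_amenable (hΓ : ¬ AmenableGroup Γ) {S : Finset Γ} (h1 : 1 ∈ S)
    (hgen : Subgroup.closure (S : Set Γ) = ⊤) :
    ‖L2.convOp S.toMonoidAlgebra‖ < S.card := by
  by_contra! hc
  apply hΓ
  choose f hf hfS using fun n : ℕ =>
    L2.exists_almost_invariant h1 hc (ε := 1 / ((n : ℝ) + 1)) (by positivity)
  -- The invariant mean is the limit of the masses along a nonprincipal ultrafilter, which exists
  -- because they lie in `[0, 1]`.
  have hlim : ∀ A : Set Γ, ∃ a : ℝ, a ∈ Icc (0 : ℝ) 1 ∧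
      Tendsto (fun n => L2.mass (f n) A) (hyperfilter ℕ) (𝓝 a) := by
    intro A
    obtain ⟨a, ha, h⟩ := isCompact_Icc.ultrafilter_le_nhds
      ((hyperfilter ℕ).map fun n => L2.mass (f n) A)
      (le_principal_iff.mpr (Ultrafilter.mem_map.mpr
        (univ_mem' fun n => L2.mass_mem_Icc (hf n) A)))
    exact ⟨a, ha, h⟩
  choose m hm hmt using hlim
  have hunion : ∀ A B : Set Γ, Disjoint A B → m (A ∪ B) = m A + m B := by
    intro A B h
    refine tendsto_nhds_unique (hmt _) (((hmt A).add (hmt B)).congr fun n => ?_)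
    exact (L2.mass_union _ h).symm
  have hgenS : ∀ g ∈ S, ∀ A, m (g • A) = m A := by
    intro g hg A
    have h2 : Tendsto (fun n => L2.mass (f n) (g • A) - L2.mass (f n) A) (hyperfilter ℕ) (𝓝 0) := by
      have h3 : Tendsto (fun n : ℕ => 2 * (1 / ((n : ℝ) + 1))) (hyperfilter ℕ) (𝓝 0) := by
        have := (tendsto_one_div_add_atTop_nhds_zero_nat (𝕜 := ℝ)).const_mul 2
        rw [mul_zero] at this
        exact this.mono_left Nat.hyperfilter_le_atTop
      refine squeeze_zero_norm (fun n => ?_) h3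
      refine (L2.abs_mass_smul_sub_le (hf n) g A).trans ?_
      gcongr
      exact hfS n g hg
    have := tendsto_nhds_unique h2 ((hmt _).sub (hmt _))
    linarith
  have hall : ∀ g : Γ, ∀ A, m (g • A) = m A := by
    intro g
    have hg : g ∈ Subgroup.closure (S : Set Γ) := hgen ▸ Subgroup.mem_top g
    induction hg using Subgroup.closure_induction with
    | mem g hg => exact hgenS g hg
    | one => intro A; rw [one_smul]
    | mul g h _ _ ihg ihh => intro A; rw [mul_smul, ihg, ihh]
    | inv g _ ih => intro A; rw [← ih (g⁻¹ • A), smul_inv_smul]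
  refine ⟨fun A => ENNReal.ofReal (m A), ?_, ?_, ?_⟩
  · have : m univ = 1 := by
      refine tendsto_nhds_unique (hmt univ) (tendsto_const_nhds.congr fun n => ?_)
      exact (L2.mass_univ (hf n)).symm
    simp [this]
  · intro A B h
    dsimp only
    rw [hunion A B h, ENNReal.ofReal_add (hm A).1 (hm B).1]
  · intro g A
    dsimp only
    rw [hall]

end Kesten

/-! ### Generating sets with small spectral radius -/

section SmallSpectralRadius

open Filter Topology

variable {Γ : Type*} [Group Γ]

/-- The coefficient counts words of length `k` in `S` with product `g`; inverting and reversing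
words is a bijection. In the induction, the first letter is split off on one side and the last on
the other. -/
lemma coeff_toMonoidAlgebra_pow_inv {S : Finset Γ} (hS : ∀ s ∈ S, s⁻¹ ∈ S) (k : ℕ) (g : Γ) :
    (S.toMonoidAlgebra ^ k).coeff g⁻¹ = (S.toMonoidAlgebra ^ k).coeff g := by
  classical
  induction k generalizing g with
  | zero => simp [MonoidAlgebra.one_def, Finsupp.single_apply, eq_comm]
  | succ k ih =>
    have h1 : (S.toMonoidAlgebra ^ (k + 1)).coeff g⁻¹
        = ∑ s ∈ S, (S.toMonoidAlgebra ^ k).coeff (g * s) := by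
      rw [pow_succ', Finset.coeff_toMonoidAlgebra_mul]
      exact Finset.sum_congr rfl fun s _ => by rw [← mul_inv_rev, ih]
    have h2 : (S.toMonoidAlgebra ^ (k + 1)).coeff g
        = ∑ s ∈ S, (S.toMonoidAlgebra ^ k).coeff (g * s⁻¹) := by
      rw [pow_succ, Finset.coeff_mul_toMonoidAlgebra]
    rw [h1, h2]
    exact Finset.sum_nbij' (fun s => s⁻¹) (fun s => s⁻¹) hS hS (by simp) (by simp) (by simp)

lemma sum_coeff_toMonoidAlgebra_pow (S : Finset Γ) (k : ℕ) :
    ∑ g ∈ (S.toMonoidAlgebra ^ k).coeff.support, (S.toMonoidAlgebra ^ k).coeff g = S.card ^ k := by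
  -- The total mass is the augmentation, a ring homomorphism to `ℕ`.
  have h : ∀ b : MonoidAlgebra ℕ Γ, MonoidAlgebra.lift ℕ ℕ Γ 1 b = ∑ g ∈ b.coeff.support, b.coeff g := by
    intro b
    rw [MonoidAlgebra.lift_apply]
    simp [Finsupp.sum]
  rw [← h, map_pow, Finset.toMonoidAlgebra, map_sum]
  simp

/-- In the convolution power `1_S ^ k`, a dyadic level set carries a proportion of the mass
that is at least the inverse of the number of levels. -/
lemma exists_level_set {S : Finset Γ} (hS : ∀ s ∈ S, s⁻¹ ∈ S) (h1 : 1 ∈ S) (k : ℕ) :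
    ∃ A : Finset Γ, A.Nonempty ∧ (∀ s ∈ A, s⁻¹ ∈ A) ∧
      ‖L2.convOp A.toMonoidAlgebra‖ * (S.card : ℝ) ^ k
        ≤ 2 * (k * S.card + 1) * ‖L2.convOp S.toMonoidAlgebra‖ ^ k * A.card := by
  classical
  set b := S.toMonoidAlgebra ^ k with hb
  set d := S.card with hd
  have hd0 : 0 < d := Finset.card_pos.mpr ⟨1, h1⟩
  set L := Nat.log 2 (d ^ k) with hL
  set A : ℕ → Finset Γ := fun j => b.coeff.support.filter fun g => Nat.log 2 (b.coeff g) = j with hA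
  have hsum : ∑ g ∈ b.coeff.support, b.coeff g = d ^ k := sum_coeff_toMonoidAlgebra_pow S k
  have hlevel : ∑ j ∈ Finset.range (L + 1), ∑ g ∈ A j, b.coeff g = d ^ k := by
    rw [← hsum]
    refine Finset.sum_fiberwise_of_maps_to (fun g hg => ?_) _
    rw [Finset.mem_range, Nat.lt_succ_iff]
    refine Nat.log_mono_right ?_
    rw [← hsum]
    exact Finset.single_le_sum (f := fun g => b.coeff g) (fun _ _ => Nat.zero_le _) hg
  -- Pigeonhole over the `L + 1` dyadic levels.
  obtain ⟨j, hj, hjle⟩ : ∃ j ∈ Finset.range (L + 1), d ^ k ≤ (L + 1) * ∑ g ∈ A j, b.coeff g := by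
    by_contra! hc
    have := Finset.sum_lt_sum_of_nonempty (s := Finset.range (L + 1)) (by simp) hc
    rw [← Finset.mul_sum, hlevel] at this
    simp at this
  have hAcard : ∑ g ∈ A j, b.coeff g ≤ (A j).card * 2 ^ (j + 1) := by
    rw [← smul_eq_mul]
    refine Finset.sum_le_card_nsmul _ _ _ fun g hg => ?_
    have : Nat.log 2 (b.coeff g) = j := (Finset.mem_filter.mp hg).2
    rw [← this]
    exact (Nat.lt_pow_succ_log_self (by norm_num) _).le
  have hpos : 0 < d ^ k := pow_pos hd0 k
  refine ⟨A j, ?_, ?_, ?_⟩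
  · rw [Finset.nonempty_iff_ne_empty]
    intro he
    rw [he] at hjle
    simp at hjle
    omega
  · intro s hs
    rw [Finset.mem_filter, Finsupp.mem_support_iff] at hs ⊢
    rwa [coeff_toMonoidAlgebra_pow_inv hS]
  -- Pointwise `2^j 1_A ≤ b` on the level set, so monotonicity of the norm applies.
  · have hT : (2 : ℝ) ^ j * ‖L2.convOp (A j).toMonoidAlgebra‖
        ≤ ‖L2.convOp S.toMonoidAlgebra‖ ^ k := by
      have e1 : ‖L2.convOp ((2 ^ j : ℕ) • (A j).toMonoidAlgebra)‖ ≤ ‖L2.convOp b‖ := by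
        refine L2.norm_convOp_mono fun g => ?_
        have : ((2 ^ j : ℕ) • (A j).toMonoidAlgebra).coeff g
            = 2 ^ j * (if g ∈ A j then 1 else 0) := by
          rw [← Finset.coeff_toMonoidAlgebra, MonoidAlgebra.coeff_smul, Finsupp.smul_apply,
            smul_eq_mul]
        rw [this]
        split_ifs with hg
        · rw [Finset.mem_filter, Finsupp.mem_support_iff] at hg
          rw [mul_one, ← hg.2]
          exact Nat.pow_log_le_self 2 hg.1
        · simp
      have e2 : ‖L2.convOp b‖ ≤ ‖L2.convOp S.toMonoidAlgebra‖ ^ k := by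
        rw [hb, map_pow]
        rcases Nat.eq_zero_or_pos k with rfl | hk
        · rw [pow_zero, pow_zero]
          exact ContinuousLinearMap.norm_id_le
        · exact norm_pow_le' _ hk
      rw [map_nsmul, ← Nat.cast_smul_eq_nsmul ℝ, norm_smul] at e1
      simp only [Nat.cast_pow, Nat.cast_ofNat, norm_pow, Real.norm_ofNat] at e1
      exact e1.trans e2
    have hLk : L ≤ k * d := by
      calc L ≤ Nat.log 2 (2 ^ (k * d)) := by
            refine Nat.log_mono_right ?_
            rw [mul_comm, pow_mul]
            exact Nat.pow_le_pow_left Nat.lt_two_pow_self.le k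
        _ = k * d := Nat.log_pow (by norm_num) _
    have hm : (d : ℝ) ^ k ≤ (k * d + 1) * ((A j).card * 2 ^ (j + 1)) := by
      have : d ^ k ≤ (k * d + 1) * ((A j).card * 2 ^ (j + 1)) :=
        hjle.trans (Nat.mul_le_mul (by omega) hAcard)
      exact_mod_cast this
    calc ‖L2.convOp (A j).toMonoidAlgebra‖ * (d : ℝ) ^ k
        ≤ ‖L2.convOp (A j).toMonoidAlgebra‖ * ((k * d + 1) * ((A j).card * 2 ^ (j + 1))) := by gcongr
      _ = 2 * (k * d + 1) * (2 ^ j * ‖L2.convOp (A j).toMonoidAlgebra‖) * (A j).card := by ring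
      _ ≤ _ := by gcongr

/-- The number of levels costs only a factor linear in `k`, while `(‖T_S‖ / |S|)^k` decays
exponentially. -/
lemma exists_finset_norm_convOp_le {S : Finset Γ} (hS : ∀ s ∈ S, s⁻¹ ∈ S) (h1 : 1 ∈ S)
    (hlt : ‖L2.convOp S.toMonoidAlgebra‖ < S.card) {ε : ℝ} (hε : 0 < ε) :
    ∃ A : Finset Γ, A.Nonempty ∧ (∀ s ∈ A, s⁻¹ ∈ A) ∧
      ‖L2.convOp A.toMonoidAlgebra‖ ≤ ε * A.card := by
  set c := ‖L2.convOp S.toMonoidAlgebra‖ with hc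
  have hd0 : (0 : ℝ) < S.card := (norm_nonneg _).trans_lt hlt
  set r := c / S.card with hr
  have hr0 : 0 ≤ r := by positivity
  have hr1 : r < 1 := by rwa [hr, div_lt_one hd0]
  have hlim : Tendsto (fun k : ℕ => 2 * (S.card * ((k : ℝ) * r ^ k) + r ^ k)) atTop (𝓝 0) := by
    have := (((tendsto_self_mul_const_pow_of_lt_one hr0 hr1).const_mul (S.card : ℝ)).add
      (tendsto_pow_atTop_nhds_zero_of_lt_one hr0 hr1)).const_mul 2
    simpa using this
  obtain ⟨k, hk⟩ := (hlim.eventually (gt_mem_nhds hε)).exists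
  obtain ⟨A, hA, hA', h⟩ := exists_level_set hS h1 k
  refine ⟨A, hA, hA', ?_⟩
  have hcr : c ^ k = r ^ k * (S.card : ℝ) ^ k := by rw [hr, div_pow]; field_simp
  rw [← hc, hcr] at h
  have hdk : (0 : ℝ) < (S.card : ℝ) ^ k := pow_pos hd0 k
  have h' : ‖L2.convOp A.toMonoidAlgebra‖ ≤ 2 * (S.card * ((k : ℝ) * r ^ k) + r ^ k) * A.card := by
    refine le_of_mul_le_mul_right (h.trans (le_of_eq ?_)) hdk
    ring
  exact h'.trans (by gcongr)

/-- A finitely generated non-amenable group has a finite symmetric generating set without `1` for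
which the spectral radius of the simple random walk is at most `1 / 2`. -/
theorem exists_generating_set_norm_convOp_le [Group.FG Γ] (hΓ : ¬ AmenableGroup Γ) :
    ∃ S : Finset Γ, Subgroup.closure (S : Set Γ) = ⊤ ∧ S.Nonempty ∧ 1 ∉ S ∧ (∀ s ∈ S, s⁻¹ ∈ S) ∧
      2 * ‖L2.convOp S.toMonoidAlgebra‖ ≤ S.card := by
  classical
  obtain ⟨S₁, hS₁⟩ := (Group.FG.out : (⊤ : Subgroup Γ).FG)
  set S₀ : Finset Γ := insert 1 (S₁ ∪ S₁.image (fun g => g⁻¹)) with hS₀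
  have hsub : (S₁ : Set Γ) ⊆ S₀ := fun g hg => by simp [hS₀, Finset.mem_coe.mp hg]
  have hgen₀ : Subgroup.closure (S₀ : Set Γ) = ⊤ :=
    top_le_iff.mp (hS₁ ▸ Subgroup.closure_mono hsub)
  have hone : 1 ∈ S₀ := Finset.mem_insert_self _ _
  have hsymm₀ : ∀ s ∈ S₀, s⁻¹ ∈ S₀ := by
    intro s hs
    simp only [hS₀, Finset.mem_insert, Finset.mem_union, Finset.mem_image] at hs ⊢
    rcases hs with rfl | hs | ⟨t, ht, rfl⟩
    · simp
    · exact Or.inr (Or.inr ⟨s, hs, rfl⟩)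
    · simp [ht]
  have hlt := norm_convOp_lt_of_not_amenable hΓ hone hgen₀
  -- A nonempty `A` has norm at least `1`, so this `ε` forces `|A| ≥ 4(|S₀| + 1)`. Then the norm for
  -- `A ∪ S₀` is at most `|A|/4 + |S₀| ≤ |A|/2 - 1`, which also absorbs the loss of the element `1`.
  obtain ⟨A, hA, hA', hAle⟩ := exists_finset_norm_convOp_le hsymm₀ hone hlt
    (ε := 1 / (4 * ((S₀.card : ℝ) + 1))) (by positivity)
  have hAbig : 4 * ((S₀.card : ℝ) + 1) ≤ A.card := by
    obtain ⟨a, ha⟩ := hA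
    have h1 := L2.coeff_le_norm_convOp A.toMonoidAlgebra a
    rw [Finset.coeff_toMonoidAlgebra, if_pos ha, Nat.cast_one] at h1
    have := h1.trans hAle
    rwa [div_mul_eq_mul_div, one_mul, one_le_div (by positivity)] at this
  set S : Finset Γ := (A ∪ S₀).erase 1 with hS
  have hScard : A.card ≤ S.card + 1 := by
    have : S.card + 1 = (A ∪ S₀).card := Finset.card_erase_add_one (by simp [hone])
    rw [this]
    exact Finset.card_le_card Finset.subset_union_left
  have hScard' : (A.card : ℝ) ≤ S.card + 1 := by exact_mod_cast hScard
  have hS₀0 : (0 : ℝ) ≤ S₀.card := Nat.cast_nonneg _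
  refine ⟨S, ?_, ?_, by simp [hS], ?_, ?_⟩
  · rw [eq_top_iff, ← hgen₀, Subgroup.closure_le]
    intro g hg
    by_cases hg1 : g = 1
    · rw [hg1]; exact one_mem _
    · exact Subgroup.subset_closure (by simp [hS, hg1, Finset.mem_coe.mp hg])
  · rw [← Finset.card_pos]
    have : (0 : ℝ) < S.card := by linarith
    exact_mod_cast this
  · intro s hs
    simp only [hS, Finset.mem_erase, Finset.mem_union] at hs ⊢
    exact ⟨by simpa using hs.1, hs.2.imp (hA' s) (hsymm₀ s)⟩
  · have hnorm : ‖L2.convOp S.toMonoidAlgebra‖ ≤ ‖L2.convOp A.toMonoidAlgebra‖ + S₀.card := by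
      have e1 : ‖L2.convOp S.toMonoidAlgebra‖
          ≤ ‖L2.convOp (A.toMonoidAlgebra + S₀.toMonoidAlgebra)‖ := by
        refine L2.norm_convOp_mono fun g => ?_
        rw [MonoidAlgebra.coeff_add, Finsupp.add_apply, Finset.coeff_toMonoidAlgebra,
          Finset.coeff_toMonoidAlgebra, Finset.coeff_toMonoidAlgebra]
        have : g ∈ S → g ∈ A ∨ g ∈ S₀ := by
          simp only [hS, Finset.mem_erase, Finset.mem_union]; tauto
        split_ifs <;> first | omega | tauto
      rw [map_add] at e1
      exact e1.trans ((norm_add_le _ _).trans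
        (add_le_add_right (L2.norm_convOp_toMonoidAlgebra_le S₀) _))
    have hsmall : ‖L2.convOp A.toMonoidAlgebra‖ ≤ A.card / 4 := by
      refine hAle.trans ?_
      rw [div_mul_eq_mul_div, one_mul]
      exact div_le_div_of_nonneg_left (Nat.cast_nonneg _) (by norm_num) (by linarith)
    linarith

end SmallSpectralRadius

/-! ## Sums of Bernoulli weights -/

/-- Below the curve `‖z‖ ‖1 - z‖ ^ h = q (1 - q) ^ h`, the weight `z ^ a (1 - z) ^ b` with
`h a ≤ b` is dominated by its value at `q`. -/
lemma norm_pow_mul_pow_le_of_mul_rpow_le {q h : ℝ} (hq0 : 0 < q) (hq1 : q < 1) (hh : 0 < h) {z : ℂ}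
    (hqz : q < ‖z‖) (hz : ‖z‖ / q * (‖1 - z‖ / (1 - q)) ^ h < 1) {a b : ℕ} (hab : h * a ≤ b) :
    ‖z ^ a * (1 - z) ^ b‖ ≤ q ^ a * (1 - q) ^ b := by
  have hq1' : 0 < 1 - q := by linarith
  set u := ‖z‖ / q with hu
  set v := ‖1 - z‖ / (1 - q) with hv
  have hu1 : 1 ≤ u := by rw [hu, one_le_div hq0]; exact hqz.le
  have hv0 : 0 ≤ v := by positivity
  have hvh : 0 ≤ v ^ h := Real.rpow_nonneg hv0 h
  -- As `u ≥ 1` and `u v^h < 1`, also `v ≤ 1`; hence the exponent `b` may be lowered to `ha`.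
  have hv1 : v ≤ 1 := by
    by_contra! hc
    have : 1 ≤ v ^ h := Real.one_le_rpow hc.le hh.le
    nlinarith
  have hvb : v ^ b ≤ (v ^ h) ^ a := by
    rw [← Real.rpow_natCast v b, ← Real.rpow_mul_natCast hv0]
    exact Real.rpow_le_rpow_of_exponent_ge' hv0 hv1 (by positivity) hab
  have key : u ^ a * v ^ b ≤ 1 := by
    calc u ^ a * v ^ b ≤ u ^ a * (v ^ h) ^ a := by gcongr
      _ = (u * v ^ h) ^ a := by rw [mul_pow]
      _ ≤ 1 := pow_le_one₀ (by positivity) hz.le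
  have h1 : ‖z‖ = q * u := by rw [hu]; field_simp
  have h2 : ‖1 - z‖ = (1 - q) * v := by rw [hv]; field_simp
  rw [norm_mul, norm_pow, norm_pow, h1, h2, mul_pow, mul_pow]
  calc _ = (q ^ a * (1 - q) ^ b) * (u ^ a * v ^ b) := by ring
    _ ≤ (q ^ a * (1 - q) ^ b) * 1 := by gcongr
    _ = _ := mul_one _

/-- The function `x(1-x)^h` has its strict maximum at `1/(1+h)`. In the normalised factors this is
`t ≤ exp(t - 1)`, strict for `u ≠ 1`, and the exponents cancel since `(u - 1) + h(v - 1) = 0`. -/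
lemma div_mul_rpow_lt_one {h x : ℝ} (hh : 0 < h) (hx : 1 / (1 + h) < x) (hx1 : x ≤ 1) :
    x / (1 / (1 + h)) * ((1 - x) / (1 - 1 / (1 + h))) ^ h < 1 := by
  have h1 : 1 - 1 / (1 + h) = h / (1 + h) := by field_simp; ring
  have hu : x / (1 / (1 + h)) = x * (1 + h) := by field_simp
  have hv : (1 - x) / (1 - 1 / (1 + h)) = (1 - x) * (1 + h) / h := by rw [h1]; field_simp
  rw [hu, hv]
  set u := x * (1 + h) with hu'
  set v := (1 - x) * (1 + h) / h with hv'
  have hv0 : 0 ≤ v := by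
    have : 0 ≤ 1 - x := by linarith
    positivity
  have hx' : 1 < u := by rwa [div_lt_iff₀ (by positivity)] at hx
  have e1 : u < Real.exp (u - 1) := by
    have := Real.add_one_lt_exp (x := u - 1) (by linarith)
    linarith
  have e2 : v ≤ Real.exp (v - 1) := by
    have := Real.add_one_le_exp (v - 1)
    linarith
  have e3 : v ^ h ≤ Real.exp ((v - 1) * h) := by
    rw [Real.exp_mul]
    exact Real.rpow_le_rpow hv0 e2 hh.le
  have e4 : (u - 1) + (v - 1) * h = 0 := by
    rw [hu', hv']; field_simp; ring
  calc u * v ^ h ≤ u * Real.exp ((v - 1) * h) := by gcongr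
    _ < Real.exp (u - 1) * Real.exp ((v - 1) * h) := by gcongr
    _ = 1 := by rw [← Real.exp_add, e4, Real.exp_zero]

/-- A sum of Bernoulli weights with at least `h` times as many failures as successes, summable at
`1 / (1 + h)`, is analytic on `(1 / (1 + h), 1]`. -/
lemma analyticAt_tsum_pow_mul_pow {ι : Type*} {h : ℝ} (hh : 0 < h) (a b : ι → ℕ)
    (hab : ∀ i, h * a i ≤ b i)
    (hs : Summable fun i => (1 / (1 + h)) ^ a i * (1 - 1 / (1 + h)) ^ b i) {x : ℝ}
    (hx : x ∈ Ioc (1 / (1 + h)) 1) :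
    AnalyticAt ℝ (fun t : ℝ => ∑' i, t ^ a i * (1 - t) ^ b i) x := by
  set q := 1 / (1 + h) with hq
  have hq0 : 0 < q := by positivity
  have hq1 : q < 1 := by rw [hq, div_lt_one (by positivity)]; linarith
  set U : Set ℂ := {z | q < ‖z‖ ∧ ‖z‖ / q * (‖1 - z‖ / (1 - q)) ^ h < 1} with hU
  have hUo : IsOpen U := by
    have h1 : Continuous fun z : ℂ => ‖z‖ / q := by fun_prop
    have h2 : Continuous fun z : ℂ => (‖1 - z‖ / (1 - q)) ^ h :=
      (by fun_prop : Continuous fun z : ℂ => ‖1 - z‖ / (1 - q)).rpow_const fun _ => Or.inr hh.le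
    exact (isOpen_lt continuous_const continuous_norm).inter
      (isOpen_lt (h1.mul h2) continuous_const)
  have hxU : (x : ℂ) ∈ U := by
    have hx0 : 0 ≤ x := hq0.le.trans hx.1.le
    have n1 : ‖(x : ℂ)‖ = x := by rw [Complex.norm_real, Real.norm_of_nonneg hx0]
    have n2 : ‖1 - (x : ℂ)‖ = 1 - x := by
      rw [← Complex.ofReal_one, ← Complex.ofReal_sub, Complex.norm_real,
        Real.norm_of_nonneg (by linarith [hx.2])]
    refine ⟨by rw [n1]; exact hx.1, ?_⟩
    rw [n1, n2]
    exact div_mul_rpow_lt_one hh hx.1 hx.2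
  -- Weierstrass M-test on `U`, with the terms at `q` as majorants.
  have hd : DifferentiableOn ℂ (fun z : ℂ => ∑' i, z ^ a i * (1 - z) ^ b i) U :=
    Complex.differentiableOn_tsum_of_summable_norm hs (fun i => by fun_prop) hUo
      fun i z hz => norm_pow_mul_pow_le_of_mul_rpow_le hq0 hq1 hh hz.1 hz.2 (hab i)
  have ha : AnalyticAt ℂ (fun z : ℂ => ∑' i, z ^ a i * (1 - z) ^ b i) x :=
    hd.analyticAt (hUo.mem_nhds hxU)
  refine ha.re_ofReal.congr (Filter.Eventually.of_forall fun t => ?_)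
  have : (∑' i, (t : ℂ) ^ a i * (1 - (t : ℂ)) ^ b i)
      = ((∑' i, t ^ a i * (1 - t) ^ b i : ℝ) : ℂ) := by
    rw [Complex.ofReal_tsum]; push_cast; rfl
  simp only [this, Complex.ofReal_re]

/-! ## Exploration of finite clusters -/

namespace SimpleGraph

section Cylinder

variable {V : Type*} (G : SimpleGraph V)

instance (p : unitInterval) : IsProbabilityMeasure (G.bondPerc p) := by
  unfold bondPerc; infer_instance

/-- The event that all edges of `A` are occupied and all edges of `B` are vacant. -/
def edgeCylinder (A B : Finset G.edgeSet) : Set G.PercInstance :=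
  {ω | (∀ e ∈ A, ω e = true) ∧ ∀ e ∈ B, ω e = false}

open Classical in
lemma edgeCylinder_eq_pi {A B : Finset G.edgeSet} (h : Disjoint A B) :
    G.edgeCylinder A B
      = Set.pi ((A ∪ B : Finset G.edgeSet) : Set G.edgeSet)
        (fun e => if e ∈ A then {true} else {false}) := by
  ext ω
  simp only [edgeCylinder, mem_ofPred_eq, Set.mem_pi, Finset.mem_coe, Finset.mem_union]
  constructor
  · rintro ⟨hA, hB⟩ e he
    by_cases heA : e ∈ A
    · simp [heA, hA e heA]
    · simp [heA, hB e (he.resolve_left heA)]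
  · intro H
    refine ⟨fun e he => ?_, fun e he => ?_⟩
    · simpa [he] using H e (Or.inl he)
    · have := Finset.disjoint_right.mp h he
      simpa [this] using H e (Or.inr he)

lemma measurableSet_edgeCylinder {A B : Finset G.edgeSet} (h : Disjoint A B) :
    MeasurableSet (G.edgeCylinder A B) := by
  classical
  rw [edgeCylinder_eq_pi G h]
  exact .pi (Finset.countable_toSet _) fun _ _ => .of_discrete

lemma bondPerc_edgeCylinder (p : unitInterval) {A B : Finset G.edgeSet} (h : Disjoint A B) :
    G.bondPerc p (G.edgeCylinder A B)
      = ENNReal.ofReal ((p : ℝ) ^ A.card * (1 - (p : ℝ)) ^ B.card) := by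
  classical
  have hp := p.2.1
  have hp' : (0 : ℝ) ≤ 1 - p := by linarith [p.2.2]
  rw [edgeCylinder_eq_pi G h, bondPerc, Measure.infinitePi_pi _ fun _ _ => .of_discrete,
    Finset.prod_union h]
  have h1 : ∀ e ∈ A, ProbabilityTheory.bernoulliMeasure true false p
      (if e ∈ A then {true} else {false}) = ENNReal.ofReal p := by
    intro e he
    rw [if_pos he, ProbabilityTheory.bernoulliMeasure_apply_of_mem_of_notMem p (.of_discrete)
      (by simp) (by simp)]
    exact (ENNReal.ofReal_eq_coe_nnreal hp).symm
  have h2 : ∀ e ∈ B, ProbabilityTheory.bernoulliMeasure true false p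
      (if e ∈ A then {true} else {false}) = ENNReal.ofReal (1 - p) := by
    intro e he
    rw [if_neg (Finset.disjoint_right.mp h he),
      ProbabilityTheory.bernoulliMeasure_apply_of_notMem_of_mem p (.of_discrete)
      (by simp) (by simp)]
    exact (ENNReal.ofReal_eq_coe_nnreal hp').symm
  rw [Finset.prod_congr rfl h1, Finset.prod_congr rfl h2, Finset.prod_const, Finset.prod_const,
    ENNReal.ofReal_mul (by positivity), ENNReal.ofReal_pow hp, ENNReal.ofReal_pow hp']

end Cylinder

section Exploration

variable {V : Type*} (G : SimpleGraph V)

/-- A stage of the exploration of a cluster: the vertices found, the edges found occupied and the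
edges found vacant. -/
structure ExplorationState where
  verts : Finset V
  occ : Finset G.edgeSet
  vac : Finset G.edgeSet

variable {G}

/-- `(x, y)` is an unexplored edge leaving the explored part of the cluster. -/
def ExplorationState.Frontier (σ : G.ExplorationState) (q : V × V) : Prop :=
  q.1 ∈ σ.verts ∧ q.2 ∉ σ.verts ∧ ∃ h : G.Adj q.1 q.2, (⟨s(q.1, q.2), h⟩ : G.edgeSet) ∉ σ.vac

/-- The exploration is finished. -/
def ExplorationState.Terminal (σ : G.ExplorationState) : Prop := ¬ ∃ q, σ.Frontier q

open Classical in
/-- One step of the exploration: examine an edge of the frontier, chosen as a function of the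
current state. -/
noncomputable def ExplorationState.step (ω : G.PercInstance) (σ : G.ExplorationState) :
    G.ExplorationState :=
  if h : ∃ q, σ.Frontier q then
    let e : G.edgeSet := ⟨s(h.choose.1, h.choose.2), h.choose_spec.2.2.choose⟩
    if ω e = true then ⟨insert h.choose.2 σ.verts, insert e σ.occ, σ.vac⟩
    else ⟨σ.verts, σ.occ, insert e σ.vac⟩
  else σ

/-- The exploration of the cluster of `o` after `n` steps. -/
noncomputable def exploration (ω : G.PercInstance) (o : V) : ℕ → G.ExplorationState
  | 0 => ⟨{o}, ∅, ∅⟩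
  | n + 1 => (exploration ω o n).step ω

open Classical in
-- The examined edge depends on the state alone; the configuration enters only through the status of
-- that edge.
lemma ExplorationState.step_cases {σ : G.ExplorationState} (h : ¬ σ.Terminal) :
    ∃ x y, ∃ hxy : G.Adj x y, x ∈ σ.verts ∧ y ∉ σ.verts ∧ (⟨s(x, y), hxy⟩ : G.edgeSet) ∉ σ.vac ∧
      ∀ ω : G.PercInstance,
        (ω ⟨s(x, y), hxy⟩ = true ∧
          σ.step ω = ⟨insert y σ.verts, insert ⟨s(x, y), hxy⟩ σ.occ, σ.vac⟩) ∨
        (ω ⟨s(x, y), hxy⟩ = false ∧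
          σ.step ω = ⟨σ.verts, σ.occ, insert ⟨s(x, y), hxy⟩ σ.vac⟩) := by
  have h' : ∃ q, σ.Frontier q := not_not.mp h
  refine ⟨h'.choose.1, h'.choose.2, h'.choose_spec.2.2.choose, h'.choose_spec.1,
    h'.choose_spec.2.1, h'.choose_spec.2.2.choose_spec, fun ω => ?_⟩
  unfold ExplorationState.step
  rw [dif_pos h']
  dsimp only
  split_ifs with hω
  · exact Or.inl ⟨hω, rfl⟩
  · exact Or.inr ⟨by simpa using hω, rfl⟩

lemma ExplorationState.step_of_terminal {σ : G.ExplorationState} (h : σ.Terminal)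
    (ω : G.PercInstance) : σ.step ω = σ := dif_neg h

lemma ExplorationState.subset_step (σ : G.ExplorationState) (ω : G.PercInstance) :
    σ.occ ⊆ (σ.step ω).occ ∧ σ.vac ⊆ (σ.step ω).vac := by
  classical
  by_cases h : σ.Terminal
  · rw [σ.step_of_terminal h]; simp
  · obtain ⟨x, y, hxy, -, -, -, H⟩ := σ.step_cases h
    rcases H ω with ⟨-, h⟩ | ⟨-, h⟩ <;> rw [h] <;> simp

lemma ExplorationState.step_congr (σ : G.ExplorationState) {ω ω' : G.PercInstance}
    (h : ω' ∈ G.edgeCylinder (σ.step ω).occ (σ.step ω).vac) : σ.step ω' = σ.step ω := by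
  classical
  by_cases ht : σ.Terminal
  · rw [σ.step_of_terminal ht, σ.step_of_terminal ht]
  · obtain ⟨x, y, hxy, -, -, -, H⟩ := σ.step_cases ht
    rcases H ω with ⟨h1, h2⟩ | ⟨h1, h2⟩ <;> rcases H ω' with ⟨h3, h4⟩ | ⟨h3, h4⟩ <;>
      rw [h2] at h <;> rw [h2, h4]
    · have := h.1 ⟨s(x, y), hxy⟩ (by simp)
      simp_all
    · have := h.2 ⟨s(x, y), hxy⟩ (by simp)
      simp_all

/-- The exploration reads only edges that it records, so its stage is determined by the recorded
edges. This makes each outcome a cylinder event. -/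
lemma exploration_congr {ω ω' : G.PercInstance} {o : V} (n : ℕ)
    (h : ω' ∈ G.edgeCylinder (exploration ω o n).occ (exploration ω o n).vac) :
    exploration ω' o n = exploration ω o n := by
  induction n with
  | zero => rfl
  | succ n ih =>
    have hs := (exploration ω o n).subset_step ω
    have : exploration ω' o n = exploration ω o n :=
      ih ⟨fun e he => h.1 e (hs.1 he), fun e he => h.2 e (hs.2 he)⟩
    simp only [exploration] at h ⊢
    rw [this]
    exact ExplorationState.step_congr _ h

/-- The properties that hold throughout the exploration of the cluster of `o` in `ω`. -/
structure ExplorationState.Valid (ω : G.PercInstance) (o : V) (σ : G.ExplorationState) : Prop where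
  mem : o ∈ σ.verts
  reachable : ∀ x ∈ σ.verts, (G.occupied ω).Reachable o x
  occ_true : ∀ e ∈ σ.occ, ω e = true
  vac_false : ∀ e ∈ σ.vac, ω e = false
  occ_sub : ∀ e ∈ σ.occ, ∀ x ∈ (e : Sym2 V), x ∈ σ.verts
  vac_touch : ∀ e ∈ σ.vac, ∃ x ∈ (e : Sym2 V), x ∈ σ.verts
  card : σ.occ.card + 1 = σ.verts.card

/-- An occupied edge is examined only if it leads to a new vertex, so edges and vertices grow
together and the tree count `card` persists. -/
lemma ExplorationState.Valid.step {ω : G.PercInstance} {o : V} {σ : G.ExplorationState}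
    (hσ : σ.Valid ω o) : (σ.step ω).Valid ω o := by
  classical
  by_cases ht : σ.Terminal
  · rwa [σ.step_of_terminal ht]
  · obtain ⟨x, y, hxy, hx, hy, hv, H⟩ := σ.step_cases ht
    rcases H ω with ⟨h1, h2⟩ | ⟨h1, h2⟩ <;> rw [h2]
    · have hnot : (⟨s(x, y), hxy⟩ : G.edgeSet) ∉ σ.occ := fun hc =>
        hy (hσ.occ_sub _ hc y (by simp))
      refine ⟨by simp [hσ.mem], ?_, ?_, hσ.vac_false, ?_, ?_, ?_⟩
      · intro z hz
        rcases Finset.mem_insert.mp hz with rfl | hz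
        · have : (G.occupied ω).Adj x z := ⟨hxy, h1⟩
          exact (hσ.reachable x hx).trans this.reachable
        · exact hσ.reachable z hz
      · intro e he
        rcases Finset.mem_insert.mp he with rfl | he
        · exact h1
        · exact hσ.occ_true e he
      · intro e he z hz
        rcases Finset.mem_insert.mp he with rfl | he
        · rcases Sym2.mem_iff.mp hz with rfl | rfl
          · exact Finset.mem_insert_of_mem hx
          · exact Finset.mem_insert_self _ _
        · exact Finset.mem_insert_of_mem (hσ.occ_sub e he z hz)
      · intro e he
        obtain ⟨z, hz, hz'⟩ := hσ.vac_touch e he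
        exact ⟨z, hz, Finset.mem_insert_of_mem hz'⟩
      · rw [Finset.card_insert_of_notMem hnot, Finset.card_insert_of_notMem hy, hσ.card]
    · refine ⟨hσ.mem, hσ.reachable, hσ.occ_true, ?_, hσ.occ_sub, ?_, hσ.card⟩
      · intro e he
        rcases Finset.mem_insert.mp he with rfl | he
        · exact h1
        · exact hσ.vac_false e he
      · intro e he
        rcases Finset.mem_insert.mp he with rfl | he
        · exact ⟨x, by simp, hx⟩
        · exact hσ.vac_touch e he

lemma valid_exploration (ω : G.PercInstance) (o : V) (n : ℕ) :
    (exploration ω o n).Valid ω o := by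
  induction n with
  | zero => constructor <;> simp [exploration]
  | succ n ih => exact ih.step

lemma ExplorationState.Valid.disjoint {ω : G.PercInstance} {o : V} {σ : G.ExplorationState}
    (hσ : σ.Valid ω o) : Disjoint σ.occ σ.vac := by
  rw [Finset.disjoint_left]
  intro e he he'
  have h1 := hσ.occ_true e he
  rw [hσ.vac_false e he'] at h1
  cases h1

/-- At a terminal state every edge leaving the found vertices is vacant, so no occupied walk can
leave them. -/
lemma ExplorationState.Valid.cluster_eq {ω : G.PercInstance} {o : V} {σ : G.ExplorationState}
    (hσ : σ.Valid ω o) (ht : σ.Terminal) : G.cluster ω o = σ.verts := by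
  apply Subset.antisymm
  · rintro v ⟨w⟩
    suffices H : ∀ {a b : V} (_ : (G.occupied ω).Walk a b), a ∈ σ.verts → b ∈ σ.verts from
      H w hσ.mem
    intro a b w
    induction w with
    | nil => exact id
    | cons hab _ ih =>
      intro ha
      apply ih
      by_contra hb
      obtain ⟨h1, h2⟩ := hab
      refine ht ⟨(_, _), ha, hb, h1, fun hc => ?_⟩
      rw [hσ.vac_false _ hc] at h2
      cases h2
  · intro v hv
    exact hσ.reachable v hv

lemma ExplorationState.Terminal.edgeBoundary_subset {σ : G.ExplorationState} (ht : σ.Terminal) :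
    G.edgeBoundary σ.verts ⊆ Subtype.val '' (σ.vac : Set G.edgeSet) := by
  rintro e ⟨x, hx, y, hy, hxy, rfl⟩
  refine ⟨⟨s(x, y), hxy⟩, ?_, rfl⟩
  by_contra hc
  exact ht ⟨(x, y), hx, hy, hxy, hc⟩

lemma exploration_eq_of_terminal {ω : G.PercInstance} {o : V} {m n : ℕ} (hmn : m ≤ n)
    (h : (exploration ω o m).Terminal) : exploration ω o n = exploration ω o m := by
  induction n, hmn using Nat.le_induction with
  | base => rfl
  | succ n _ ih => rw [exploration, ih, ExplorationState.step_of_terminal h]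

/-- Each non-terminal step records a new edge, and all recorded edges touch the cluster; a finite
cluster in a locally finite graph has only finitely many such edges. -/
lemma exists_exploration_terminal (hd : ∀ v, (G.neighborSet v).Finite) {ω : G.PercInstance} {o : V}
    (hfin : (G.cluster ω o).Finite) : ∃ n, (exploration ω o n).Terminal := by
  classical
  by_contra! hc
  have hcard : ∀ n, ((exploration ω o n).occ ∪ (exploration ω o n).vac).card = n := by
    intro n
    rw [Finset.card_union_of_disjoint (valid_exploration ω o n).disjoint]
    induction n with
    | zero => simp [exploration]
    | succ n ih =>
      obtain ⟨x, y, hxy, hx, hy, hv, H⟩ := ExplorationState.step_cases (hc n)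
      have hnot : (⟨s(x, y), hxy⟩ : G.edgeSet) ∉ (exploration ω o n).occ := fun h =>
        hy ((valid_exploration ω o n).occ_sub _ h y (by simp))
      rw [exploration]
      rcases H ω with ⟨-, h2⟩ | ⟨-, h2⟩ <;> rw [h2]
      · rw [Finset.card_insert_of_notMem hnot]; dsimp only; omega
      · rw [Finset.card_insert_of_notMem hv]; dsimp only; omega
  have hE : {e : G.edgeSet | ∃ x ∈ G.cluster ω o, x ∈ (e : Sym2 V)}.Finite := by
    have h1 : (⋃ x ∈ G.cluster ω o, (fun y => s(x, y)) '' G.neighborSet x).Finite :=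
      hfin.biUnion fun x _ => (hd x).image _
    refine (h1.preimage Subtype.val_injective.injOn).subset ?_
    rintro ⟨e, he⟩ ⟨x, hx, hxe⟩
    simp only [mem_preimage, mem_iUnion]
    refine ⟨x, hx, ?_⟩
    obtain ⟨y, rfl⟩ := Sym2.mem_iff_exists.mp hxe
    exact ⟨y, he, rfl⟩
  have hsub : ∀ n, ((exploration ω o n).occ ∪ (exploration ω o n).vac) ⊆ hE.toFinset := by
    intro n e he
    rw [Finite.mem_toFinset]
    have hv := valid_exploration ω o n
    rcases Finset.mem_union.mp he with he | he
    · obtain ⟨e, hxy⟩ := e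
      induction e with | _ x y =>
      exact ⟨x, hv.reachable x (hv.occ_sub _ he x (by simp)), by simp⟩
    · obtain ⟨x, hx, hx'⟩ := hv.vac_touch e he
      exact ⟨x, hv.reachable x hx', hx⟩
  have := Finset.card_le_card (hsub (hE.toFinset.card + 1))
  rw [hcard] at this
  omega

variable (G) in
/-- The possible outcomes of explorations of finite clusters of `o`. -/
def ExplorationOutcome (o : V) : Type _ :=
  {σ : G.ExplorationState // σ.Terminal ∧ ∃ ω n, exploration ω o n = σ}

lemma ExplorationOutcome.exists_exploration {o : V} (σ : G.ExplorationOutcome o)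
    {ω : G.PercInstance} (h : ω ∈ G.edgeCylinder σ.1.occ σ.1.vac) :
    ∃ n, exploration ω o n = σ.1 := by
  obtain ⟨σ, ht, ω₀, n, rfl⟩ := σ
  exact ⟨n, exploration_congr n h⟩

lemma ExplorationOutcome.disjoint {o : V} (σ : G.ExplorationOutcome o) :
    Disjoint σ.1.occ σ.1.vac := by
  obtain ⟨σ, ht, ω₀, n, rfl⟩ := σ
  exact (valid_exploration ω₀ o n).disjoint

/-- A configuration in two of the cylinders would reach both outcomes in its single exploration,
which no longer changes after the first terminal state. -/
lemma ExplorationOutcome.pairwise_disjoint (o : V) :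
    Pairwise (Function.onFun Disjoint fun σ : G.ExplorationOutcome o =>
      G.edgeCylinder σ.1.occ σ.1.vac) := by
  intro σ τ hne
  rw [Function.onFun, Set.disjoint_left]
  intro ω h1 h2
  apply hne
  obtain ⟨m, hm⟩ := σ.exists_exploration h1
  obtain ⟨n, hn⟩ := τ.exists_exploration h2
  apply Subtype.ext
  rcases le_total m n with hmn | hmn
  · rw [← hm, ← hn, exploration_eq_of_terminal hmn (hm ▸ σ.2.1)]
  · rw [← hm, ← hn, exploration_eq_of_terminal hmn (hn ▸ τ.2.1)]

lemma setOf_cluster_finite_eq (hd : ∀ v, (G.neighborSet v).Finite) (o : V) :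
    {ω | (G.cluster ω o).Finite}
      = ⋃ σ : G.ExplorationOutcome o, G.edgeCylinder σ.1.occ σ.1.vac := by
  ext ω
  simp only [mem_ofPred_eq, mem_iUnion]
  constructor
  · intro h
    obtain ⟨n, hn⟩ := exists_exploration_terminal hd h
    have hv := valid_exploration ω o n
    exact ⟨⟨_, hn, ω, n, rfl⟩, hv.occ_true, hv.vac_false⟩
  · rintro ⟨σ, h⟩
    obtain ⟨n, hn⟩ := σ.exists_exploration h
    have hv := valid_exploration ω o n
    rw [hv.cluster_eq (hn ▸ σ.2.1)]
    exact Finset.finite_toSet _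

instance [Countable V] (o : V) : Countable (G.ExplorationOutcome o) := by
  have : Countable (Sym2 V) := by unfold Sym2; infer_instance
  have : Function.Injective (fun σ : G.ExplorationState => (σ.verts, σ.occ, σ.vac)) := by
    rintro ⟨⟩ ⟨⟩ h; simpa using h
  have : Countable G.ExplorationState := this.countable
  exact Subtype.countable

lemma hasSum_bondPerc_finite [Countable V] (hd : ∀ v, (G.neighborSet v).Finite) (o : V)
    (p : unitInterval) :
    HasSum (fun σ : G.ExplorationOutcome o =>
      (p : ℝ) ^ σ.1.occ.card * (1 - (p : ℝ)) ^ σ.1.vac.card)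
      ((G.bondPerc p).real {ω | (G.cluster ω o).Finite}) := by
  have hp := p.2.1
  have hp' : (0 : ℝ) ≤ 1 - p := by linarith [p.2.2]
  have h1 : G.bondPerc p {ω | (G.cluster ω o).Finite} = ∑' σ : G.ExplorationOutcome o,
      ENNReal.ofReal ((p : ℝ) ^ σ.1.occ.card * (1 - (p : ℝ)) ^ σ.1.vac.card) := by
    rw [setOf_cluster_finite_eq hd, measure_iUnion (ExplorationOutcome.pairwise_disjoint o)
      fun σ => G.measurableSet_edgeCylinder σ.disjoint]
    exact tsum_congr fun σ => G.bondPerc_edgeCylinder p σ.disjoint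
  have h2 := (ENNReal.summable_toReal (h1 ▸ measure_ne_top _ _)).hasSum
  rw [← ENNReal.tsum_toReal_eq (fun _ => ENNReal.ofReal_ne_top), ← h1] at h2
  rw [measureReal_def]
  simpa only [ENNReal.toReal_ofReal (mul_nonneg (pow_nonneg hp _) (pow_nonneg hp' _))] using h2

end Exploration
end SimpleGraph

/-! ### The Cheeger constant and analyticity above `1 / (1 + h)` -/

namespace SimpleGraph

variable {V : Type*} {G : SimpleGraph V}

lemma BoundedDegree.finite_neighborSet (h : G.BoundedDegree) (v : V) : (G.neighborSet v).Finite := by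
  obtain ⟨d, hd⟩ := h
  exact Set.finite_of_encard_le_coe (hd v)

lemma edgeCheeger_nonneg (G : SimpleGraph V) : 0 ≤ G.edgeCheeger :=
  Real.iInf_nonneg fun _ => by positivity

lemma edgeCheeger_mul_card_le (S : Finset V) :
    G.edgeCheeger * S.card ≤ (G.edgeBoundary S).ncard := by
  rcases S.eq_empty_or_nonempty with rfl | hS
  · simp
  have hpos : (0 : ℝ) < S.card := by exact_mod_cast hS.card_pos
  rw [← le_div_iff₀ hpos]
  exact ciInf_le (f := fun S : {S : Finset V // S.Nonempty} =>
      ((G.edgeBoundary (S : Finset V)).ncard : ℝ) / (S.1.card : ℝ))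
    ⟨0, by rintro _ ⟨T, rfl⟩; positivity⟩ ⟨S, hS⟩

/-- The vacant edges cover the boundary of the found vertices, and there is one occupied edge fewer
than found vertices. -/
lemma ExplorationOutcome.edgeCheeger_mul_card_occ_le {o : V} (σ : G.ExplorationOutcome o) :
    G.edgeCheeger * σ.1.occ.card ≤ σ.1.vac.card := by
  have hv : σ.1.occ.card + 1 = σ.1.verts.card := by
    obtain ⟨σ, ht, ω₀, n, rfl⟩ := σ
    exact (valid_exploration ω₀ o n).card
  have h1 : (G.edgeBoundary σ.1.verts).ncard ≤ σ.1.vac.card := by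
    refine (Set.ncard_le_ncard σ.2.1.edgeBoundary_subset
      ((Finset.finite_toSet _).image _)).trans ?_
    refine (Set.ncard_image_le (Finset.finite_toSet _)).trans ?_
    rw [Set.ncard_coe_finset]
  calc G.edgeCheeger * σ.1.occ.card ≤ G.edgeCheeger * σ.1.verts.card := by
        gcongr
        · exact G.edgeCheeger_nonneg
        · omega
    _ ≤ (G.edgeBoundary σ.1.verts).ncard := edgeCheeger_mul_card_le _
    _ ≤ σ.1.vac.card := by exact_mod_cast h1

lemma measurableSet_cluster_finite [Countable V] (hd : ∀ v, (G.neighborSet v).Finite) (o : V) :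
    MeasurableSet {ω | (G.cluster ω o).Finite} := by
  rw [setOf_cluster_finite_eq hd]
  exact .iUnion fun σ => G.measurableSet_edgeCylinder σ.disjoint

lemma percDensity_eq_one_sub_tsum [Countable V] (hd : ∀ v, (G.neighborSet v).Finite) (o : V) {x : ℝ}
    (hx : x ∈ Icc (0 : ℝ) 1) :
    G.percDensity o x = 1 - ∑' σ : G.ExplorationOutcome o,
      x ^ σ.1.occ.card * (1 - x) ^ σ.1.vac.card := by
  rw [percDensity, IccExtend_of_mem _ _ hx, (hasSum_bondPerc_finite hd o ⟨x, hx⟩).tsum_eq,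
    ← probReal_compl_eq_one_sub (measurableSet_cluster_finite hd o)]
  rfl

theorem analyticOn_percDensity [Countable V] (hG : G.BoundedDegree) (hh : 0 < G.edgeCheeger)
    (o : V) : AnalyticOn ℝ (G.percDensity o) (Ioc (1 / (1 + G.edgeCheeger)) 1) := by
  have hd := hG.finite_neighborSet
  have hq0 : 0 < 1 / (1 + G.edgeCheeger) := by positivity
  have hq1 : 1 / (1 + G.edgeCheeger) ≤ 1 := by
    rw [div_le_one (by positivity)]; linarith
  intro x hx
  have h1 := analyticAt_tsum_pow_mul_pow hh
    (fun σ : G.ExplorationOutcome o => σ.1.occ.card) (fun σ => σ.1.vac.card)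
    (fun σ => σ.edgeCheeger_mul_card_occ_le)
    -- Summability at `q` is free: the sum is a probability.
    (hasSum_bondPerc_finite hd o ⟨1 / (1 + G.edgeCheeger), hq0.le, hq1⟩).summable hx
  have h2 : AnalyticAt ℝ (fun t : ℝ => 1 - ∑' σ : G.ExplorationOutcome o,
      t ^ σ.1.occ.card * (1 - t) ^ σ.1.vac.card) x := analyticAt_const.sub h1
  exact h2.analyticWithinAt.congr
    (fun y hy => percDensity_eq_one_sub_tsum hd o ⟨hq0.le.trans hy.1.le, hy.2⟩)
    (percDensity_eq_one_sub_tsum hd o ⟨hq0.le.trans hx.1.le, hx.2⟩)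

theorem pAnalytic_le [Countable V] (hG : G.BoundedDegree) (hh : 0 < G.edgeCheeger)
    (o : V) : G.pAnalytic o ≤ 1 / (1 + G.edgeCheeger) := by
  refine csInf_le ⟨0, fun p hp => hp.1.1⟩ ⟨⟨by positivity, ?_⟩, analyticOn_percDensity hG hh o⟩
  rw [div_le_one (by positivity)]; linarith

end SimpleGraph

/-! ### Non-uniqueness from decay of connection probabilities -/

/-- Second moment bound: many events of probability `t` cannot have pairwise intersections of
probability much less than `t ^ 2`. -/
lemma sq_mul_sq_le_of_inter_le {Ω : Type*} [MeasurableSpace Ω] {μ : Measure Ω}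
    [IsProbabilityMeasure μ] {E : ℕ → Set Ω} (hE : ∀ i, MeasurableSet (E i)) {t ε : ℝ}
    (ht : ∀ i, μ.real (E i) = t) (hε : 0 ≤ ε) (hij : ∀ i j, i ≠ j → μ.real (E i ∩ E j) ≤ ε) (n : ℕ) :
    (n : ℝ) ^ 2 * t ^ 2 ≤ n + (n : ℝ) ^ 2 * ε := by
  set X : Ω → ℝ := fun ω => ∑ i ∈ Finset.range n, (E i).indicator 1 ω with hX
  have hint : ∀ {A : Set Ω}, MeasurableSet A → Integrable (A.indicator (1 : Ω → ℝ)) μ := fun hA =>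
    (integrable_const 1).indicator hA
  have hXi : Integrable X μ := integrable_finsetSum _ fun i _ => hint (hE i)
  have hX1 : ∫ ω, X ω ∂μ = n * t := by
    rw [hX, integral_finsetSum _ fun i _ => hint (hE i)]
    simp [integral_indicator_one, hE, ht]
  have hsq : ∀ ω, X ω ^ 2
      = ∑ i ∈ Finset.range n, ∑ j ∈ Finset.range n, (E i ∩ E j).indicator (1 : Ω → ℝ) ω := by
    intro ω
    rw [sq, hX, Finset.sum_mul_sum]
    simp [inter_indicator_one]
  have hX2i : Integrable (fun ω => X ω ^ 2) μ := by
    simp_rw [hsq]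
    exact integrable_finsetSum _ fun i _ => integrable_finsetSum _ fun j _ =>
      hint ((hE i).inter (hE j))
  have hX2 : ∫ ω, X ω ^ 2 ∂μ ≤ n + (n : ℝ) ^ 2 * ε := by
    simp_rw [hsq]
    rw [integral_finsetSum _ fun i _ => integrable_finsetSum _ fun j _ =>
      hint ((hE i).inter (hE j))]
    have hrow : ∀ i ∈ Finset.range n, ∫ ω, ∑ j ∈ Finset.range n,
        (E i ∩ E j).indicator (1 : Ω → ℝ) ω ∂μ ≤ 1 + n * ε := by
      intro i hi
      rw [integral_finsetSum _ fun j _ => hint ((hE i).inter (hE j))]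
      simp_rw [fun j => integral_indicator_one (μ := μ) ((hE i).inter (hE j))]
      rw [← Finset.add_sum_erase _ _ hi]
      have hle : ∑ j ∈ (Finset.range n).erase i, μ.real (E i ∩ E j) ≤ n * ε := by
        refine (Finset.sum_le_card_nsmul _ _ ε fun j hj => hij i j
          (Finset.ne_of_mem_erase hj).symm).trans ?_
        rw [nsmul_eq_mul]
        gcongr
        exact (Finset.card_le_card (Finset.erase_subset _ _)).trans (by simp)
      exact add_le_add measureReal_le_one hle
    refine (Finset.sum_le_sum hrow).trans (le_of_eq ?_)
    rw [Finset.sum_const, Finset.card_range, nsmul_eq_mul]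
    ring
  -- The inequality is the nonnegativity of the variance of `X`, the number of events that occur.
  have hvar : 0 ≤ ∫ ω, (X ω - n * t) ^ 2 ∂μ := integral_nonneg fun ω => sq_nonneg _
  have hexp : ∫ ω, (X ω - n * t) ^ 2 ∂μ = ∫ ω, X ω ^ 2 ∂μ - (n * t) ^ 2 := by
    have : ∀ ω, (X ω - n * t) ^ 2 = X ω ^ 2 - (2 * (n * t)) * X ω + (n * t) ^ 2 := fun ω => by ring
    simp_rw [this]
    have hs : Integrable (fun ω => X ω ^ 2 - (2 * (n * t)) * X ω) μ := hX2i.sub (hXi.const_mul _)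
    rw [integral_add hs (integrable_const _),
      integral_sub hX2i (hXi.const_mul _), integral_const_mul, hX1]
    simp
    ring
  nlinarith

namespace SimpleGraph

variable {V : Type*} {G : SimpleGraph V}

/-- The probability that all the edges of a path are occupied. -/
lemma bondPerc_path (p : unitInterval) {u v : V} {w : G.Walk u v} (hw : w.IsPath) :
    G.bondPerc p {ω | ∀ e : G.edgeSet, (e : Sym2 V) ∈ w.edges → ω e = true}
      = ENNReal.ofReal ((p : ℝ) ^ w.length) := by
  classical
  set A : Finset G.edgeSet := w.edges.toFinset.subtype (· ∈ G.edgeSet) with hA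
  have hcard : A.card = w.length := by
    rw [hA, Finset.card_subtype, Finset.filter_true_of_mem, List.toFinset_card_of_nodup,
      Walk.length_edges]
    · exact hw.isTrail.edges_nodup
    · intro e he
      exact w.edges_subset_edgeSet (List.mem_toFinset.mp he)
  have hset : {ω : G.PercInstance | ∀ e : G.edgeSet, (e : Sym2 V) ∈ w.edges → ω e = true}
      = G.edgeCylinder A ∅ := by
    ext ω
    simp [edgeCylinder, hA]
  rw [hset, bondPerc_edgeCylinder G p (Finset.disjoint_empty_right A), hcard]
  simp

lemma occupied_le (ω : G.PercInstance) : G.occupied ω ≤ G := fun _ _ h => h.1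

lemma exists_path_of_mem_cluster {ω : G.PercInstance} {u v : V} (h : v ∈ G.cluster ω u) :
    ∃ w : G.Walk u v, w.IsPath ∧ ∀ e : G.edgeSet, (e : Sym2 V) ∈ w.edges → ω e = true := by
  classical
  obtain ⟨w, hw⟩ := Reachable.exists_isPath h
  refine ⟨w.mapLe (occupied_le ω), hw.mapLe _, ?_⟩
  rintro ⟨e, he⟩ hmem
  rw [Walk.edges_mapLe_eq_edges] at hmem
  have := w.edges_subset_edgeSet hmem
  induction e with | _ x y =>
  exact this.2

/-- A union bound over paths for the two-point function. -/
lemma bondPerc_mem_cluster_le [DecidableEq V] [G.LocallyFinite] (p : unitInterval) (u v : V) (N : ℕ)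
    (hN : ∀ w : G.Walk u v, N ≤ w.length) :
    G.bondPerc p {ω | v ∈ G.cluster ω u}
      ≤ ∑' m : ℕ, ENNReal.ofReal ((p : ℝ) ^ (m + N) * (G.finsetWalkLength (m + N) u v).card) := by
  classical
  have hp : (0 : ℝ) ≤ p := p.2.1
  -- Only for paths, whose edges are distinct, is the probability `p ^ length`; the restriction is
  -- dropped in the final count.
  set F : ℕ → Finset (G.Walk u v) := fun m =>
    (G.finsetWalkLength (m + N) u v).filter fun w => w.IsPath with hF
  have hsub : {ω | v ∈ G.cluster ω u} ⊆ ⋃ m : ℕ, ⋃ w ∈ F m,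
      {ω | ∀ e : G.edgeSet, (e : Sym2 V) ∈ w.edges → ω e = true} := by
    intro ω hω
    obtain ⟨w, hw, h⟩ := exists_path_of_mem_cluster hω
    simp only [mem_iUnion]
    refine ⟨w.length - N, w, ?_, h⟩
    rw [hF, Finset.mem_filter, mem_finsetWalkLength_iff]
    exact ⟨by have := hN w; omega, hw⟩
  refine (measure_mono hsub).trans ((measure_iUnion_le _).trans (ENNReal.tsum_le_tsum fun m => ?_))
  refine (measure_biUnion_finset_le _ _).trans ?_
  have : ∀ w ∈ F m, G.bondPerc p {ω | ∀ e : G.edgeSet, (e : Sym2 V) ∈ w.edges → ω e = true}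
      = ENNReal.ofReal ((p : ℝ) ^ (m + N)) := by
    intro w hw
    rw [hF, Finset.mem_filter, mem_finsetWalkLength_iff] at hw
    rw [bondPerc_path p hw.2, hw.1]
  rw [Finset.sum_congr rfl this, Finset.sum_const, nsmul_eq_mul,
    ENNReal.ofReal_mul (by positivity), mul_comm, ENNReal.ofReal_natCast]
  gcongr
  exact Finset.filter_subset _ _

/-- The percolation configuration pulled back by an automorphism. -/
def PercInstance.comap (φ : G ≃g G) (ω : G.PercInstance) : G.PercInstance :=
  fun e => ω (φ.mapEdgeSet e)

lemma cluster_apply_eq_image (φ : G ≃g G) (ω : G.PercInstance) (o : V) :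
    G.cluster ω (φ o) = φ '' G.cluster (PercInstance.comap φ ω) o := by
  have hadj : ∀ x y, (G.occupied ω).Adj (φ x) (φ y)
      ↔ (G.occupied (PercInstance.comap φ ω)).Adj x y := by
    intro x y
    constructor
    · rintro ⟨h, h'⟩; exact ⟨φ.map_adj_iff.mp h, h'⟩
    · rintro ⟨h, h'⟩; exact ⟨φ.map_adj_iff.mpr h, h'⟩
  let ψ : G.occupied (PercInstance.comap φ ω) ≃g G.occupied ω := ⟨φ.toEquiv, hadj _ _⟩
  ext v
  constructor
  · intro hv
    refine ⟨φ.symm v, ?_, φ.apply_symm_apply v⟩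
    refine ψ.reachable_iff.mp ?_
    change (G.occupied ω).Reachable (φ o) (φ (φ.symm v))
    rw [φ.apply_symm_apply]
    exact hv
  · rintro ⟨x, hx, rfl⟩
    exact (ψ.reachable_iff (u := o) (v := x)).mpr hx

lemma map_comap_bondPerc (φ : G ≃g G) (p : unitInterval) :
    (G.bondPerc p).map (PercInstance.comap φ) = G.bondPerc p :=
  Measure.map_infinitePi_infinitePi_of_inj φ.mapEdgeSet.injective

lemma measurableSet_cluster_infinite [Countable V] (hd : ∀ v, (G.neighborSet v).Finite) (o : V) :
    MeasurableSet {ω | (G.cluster ω o).Infinite} :=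
  (measurableSet_cluster_finite hd o).compl

lemma bondPerc_cluster_infinite_apply [Countable V] (hd : ∀ v, (G.neighborSet v).Finite) (φ : G ≃g G)
    (p : unitInterval) (o : V) :
    G.bondPerc p {ω | (G.cluster ω (φ o)).Infinite} = G.bondPerc p {ω | (G.cluster ω o).Infinite} := by
  have hm : Measurable (PercInstance.comap φ : G.PercInstance → G.PercInstance) :=
    measurable_pi_lambda _ fun e => measurable_pi_apply _
  conv_rhs => rw [← map_comap_bondPerc φ p, Measure.map_apply hm (measurableSet_cluster_infinite hd o)]
  congr 1
  ext ω
  simp only [mem_ofPred_eq, mem_preimage]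
  rw [cluster_apply_eq_image, infinite_image_iff φ.injective.injOn]

lemma supp_connectedComponentMk_eq_cluster (ω : G.PercInstance) (o : V) :
    ((G.occupied ω).connectedComponentMk o).supp = G.cluster ω o := by
  ext v
  rw [ConnectedComponent.mem_supp_iff, ConnectedComponent.eq]
  exact ⟨fun h => h.symm, fun h => h.symm⟩

lemma UniqueInfiniteCluster.exists_infinite {ω : G.PercInstance} (h : G.UniqueInfiniteCluster ω) :
    ∃ o, (G.cluster ω o).Infinite := by
  obtain ⟨C, hC, -⟩ := h
  induction C using ConnectedComponent.ind with | _ o =>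
  exact ⟨o, supp_connectedComponentMk_eq_cluster ω o ▸ hC⟩

lemma UniqueInfiniteCluster.mem_cluster {ω : G.PercInstance} (h : G.UniqueInfiniteCluster ω) {x y : V}
    (hx : (G.cluster ω x).Infinite) (hy : (G.cluster ω y).Infinite) : y ∈ G.cluster ω x := by
  rw [← supp_connectedComponentMk_eq_cluster] at hx hy
  exact ConnectedComponent.exact (h.unique hx hy)

lemma uniqueInfiniteCluster_of_connected [Infinite V] (hG : G.Connected) :
    G.UniqueInfiniteCluster fun _ => true := by
  have hocc : G.occupied (fun _ => true) = G := by
    ext x y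
    exact ⟨fun h => h.1, fun h => ⟨h, rfl⟩⟩
  rw [UniqueInfiniteCluster, hocc]
  obtain ⟨o⟩ := hG.nonempty
  have huniv : (G.connectedComponentMk o).supp = univ := by
    ext v
    simpa [ConnectedComponent.mem_supp_iff] using hG.preconnected v o
  have hinf : (G.connectedComponentMk o).supp.Infinite := huniv ▸ infinite_univ
  refine ⟨G.connectedComponentMk o, hinf, fun C _ => ?_⟩
  exact hG.preconnected.subsingleton_connectedComponent.elim _ _

lemma ae_uniqueInfiniteCluster_one [Countable V] [Infinite V] (hG : G.Connected) :
    ∀ᵐ ω ∂(G.bondPerc 1), G.UniqueInfiniteCluster ω := by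
  have : Countable (Sym2 V) := by unfold Sym2; infer_instance
  have h : G.bondPerc 1 = Measure.dirac (fun _ => true) := by
    simp only [bondPerc, ProbabilityTheory.bernoulliMeasure_one]
    exact Measure.infinitePi_dirac _
  rw [h, ae_dirac_eq]
  exact uniqueInfiniteCluster_of_connected hG

/-- Almost sure uniqueness of the infinite cluster is impossible if connection probabilities decay
along a sequence of vertices at which the percolation density is the same. -/
lemma not_ae_uniqueInfiniteCluster [Countable V] (hd : ∀ v, (G.neighborSet v).Finite)
    (htrans : ∀ x y : V, ∃ φ : G ≃g G, φ x = y) (p : unitInterval)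
    (hdecay : ∀ ε : ℝ, 0 < ε → ∃ x : ℕ → V, ∀ m n, m < n →
      (G.bondPerc p).real {ω | x n ∈ G.cluster ω (x m)} ≤ ε) :
    ¬ ∀ᵐ ω ∂(G.bondPerc p), G.UniqueInfiniteCluster ω := by
  intro hae
  obtain ⟨ω₀, hω₀⟩ := hae.exists
  obtain ⟨o, -⟩ := hω₀.exists_infinite
  set t := (G.bondPerc p).real {ω | (G.cluster ω o).Infinite} with ht
  have htx : ∀ x, (G.bondPerc p).real {ω | (G.cluster ω x).Infinite} = t := by
    intro x
    obtain ⟨φ, rfl⟩ := htrans o x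
    rw [measureReal_def, bondPerc_cluster_infinite_apply hd]
    rfl
  rcases eq_or_ne t 0 with h0 | h0
  · have hnull : ∀ x, ∀ᵐ ω ∂(G.bondPerc p), ¬ (G.cluster ω x).Infinite := by
      intro x
      have := htx x
      rw [h0, measureReal_eq_zero_iff] at this
      rw [ae_iff]
      simpa using this
    obtain ⟨ω, h1, h2⟩ := (hae.and (ae_all_iff.mpr hnull)).exists
    obtain ⟨x, hx⟩ := h1.exists_infinite
    exact h2 x hx
  · have ht2 : 0 < t ^ 2 := by positivity
    obtain ⟨x, hx⟩ := hdecay (t ^ 2 / 2) (by positivity)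
    -- Under uniqueness, two vertices with infinite clusters are almost surely connected.
    have hlt : ∀ m n, m < n → (G.bondPerc p).real
        ({ω | (G.cluster ω (x m)).Infinite} ∩ {ω | (G.cluster ω (x n)).Infinite}) ≤ t ^ 2 / 2 := by
      intro m n hmn
      refine le_trans ?_ (hx m n hmn)
      refine ENNReal.toReal_mono (measure_ne_top _ _) (measure_mono_ae ?_)
      filter_upwards [hae] with ω hω h
      exact hω.mem_cluster h.1 h.2
    have key := sq_mul_sq_le_of_inter_le (μ := G.bondPerc p)
      (E := fun n => {ω | (G.cluster ω (x n)).Infinite})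
      (fun n => measurableSet_cluster_infinite hd _) (fun n => htx _) (ε := t ^ 2 / 2)
      (by positivity) (fun i j hij => by
        rcases lt_or_gt_of_ne hij with h | h
        · exact hlt i j h
        · rw [inter_comm]; exact hlt j i h)
    -- The second moment bound reads `n² t² ≤ n + n² t² / 2`, which fails once `n > 2 / t²`.
    obtain ⟨n, hn⟩ := exists_nat_gt (2 / t ^ 2)
    have hn0 : (0 : ℝ) < n := lt_trans (by positivity) hn
    rw [div_lt_iff₀ ht2] at hn
    have := key n
    nlinarith

end SimpleGraph

/-! ## Cayley graphs -/

section Cayley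

variable {Γ : Type*} [Group Γ] {S : Finset Γ}

namespace SimpleGraph

lemma mulCayley_adj_iff_of_symm (h1 : 1 ∉ S) (hS : ∀ s ∈ S, s⁻¹ ∈ S) {u v : Γ} :
    (mulCayley (S : Set Γ)).Adj u v ↔ u⁻¹ * v ∈ S := by
  rw [mulCayley_adj]
  constructor
  · rintro ⟨-, h | h⟩
    · exact h
    · simpa using hS _ h
  · intro h
    refine ⟨?_, Or.inl h⟩
    rintro rfl
    simp [h1] at h

lemma mulCayley_boundedDegree (h1 : 1 ∉ S) (hS : ∀ s ∈ S, s⁻¹ ∈ S) :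
    (mulCayley (S : Set Γ)).BoundedDegree := by
  refine ⟨S.card, fun v => ?_⟩
  have hsub : (mulCayley (S : Set Γ)).neighborSet v ⊆ (fun s => v * s) '' (S : Set Γ) := by
    intro w hw
    exact ⟨v⁻¹ * w, (mulCayley_adj_iff_of_symm h1 hS).mp hw, by simp⟩
  refine (encard_le_encard hsub).trans ((encard_image_le _ _).trans ?_)
  rw [encard_coe_eq_coe_finsetCard]

lemma mulCayley_connected (hgen : Subgroup.closure (S : Set Γ) = ⊤) :
    (mulCayley (S : Set Γ)).Connected := by
  have h : ∀ g x : Γ, (mulCayley (S : Set Γ)).Reachable x (x * g) := by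
    intro g
    have hg : g ∈ Subgroup.closure (S : Set Γ) := hgen ▸ Subgroup.mem_top g
    induction hg using Subgroup.closure_induction with
    | mem g hg =>
      intro x
      by_cases hg1 : g = 1
      · simp [hg1]
      · refine Adj.reachable ?_
        rw [mulCayley_adj]
        exact ⟨by simpa using hg1, Or.inl (by simpa using hg)⟩
    | one => intro x; simp
    | mul a b _ _ iha ihb => intro x; rw [← mul_assoc]; exact (iha x).trans (ihb _)
    | inv a _ ih => intro x; simpa using (ih (x * a⁻¹)).symm
  exact (connected_iff _).mpr ⟨fun x y => by simpa using h (x⁻¹ * y) x, ⟨1⟩⟩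

/-- Left translation as an automorphism of a Cayley graph. -/
def mulCayleyLeft (S : Set Γ) (g : Γ) : mulCayley S ≃g mulCayley S :=
  ⟨Equiv.mulLeft g, mulCayley_adj_mul_iff_right⟩

/-- The increments of a walk from `u` to `v` form a word in `S` with product `u⁻¹ * v`, and the
coefficient counts such words. -/
lemma card_finsetWalkLength_mulCayley_le [DecidableEq Γ] [(mulCayley (S : Set Γ)).LocallyFinite]
    (h1 : 1 ∉ S) (hS : ∀ s ∈ S, s⁻¹ ∈ S) (n : ℕ) (u v : Γ) :
    ((mulCayley (S : Set Γ)).finsetWalkLength n u v).card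
      ≤ (S.toMonoidAlgebra ^ n).coeff (u⁻¹ * v) := by
  classical
  induction n generalizing u with
  | zero =>
    by_cases h : u = v
    · subst h
      simp [finsetWalkLength, MonoidAlgebra.one_def]
    · simp [finsetWalkLength, h]
  | succ n ih =>
    rw [pow_succ', Finset.coeff_toMonoidAlgebra_mul, finsetWalkLength]
    refine Finset.card_biUnion_le.trans ?_
    simp only [Finset.card_map]
    refine (Finset.sum_le_sum fun (w : (mulCayley (S : Set Γ)).neighborSet u) _ =>
      ih (w : Γ)).trans (le_of_eq ?_)
    refine Finset.sum_bij (fun (w : (mulCayley (S : Set Γ)).neighborSet u) _ => u⁻¹ * (w : Γ))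
      (fun w _ => (mulCayley_adj_iff_of_symm h1 hS).mp w.2) (fun w _ w' _ h => ?_)
      (fun s hs => ?_) (fun w _ => ?_)
    · exact Subtype.ext (mul_left_cancel h)
    · exact ⟨⟨u * s, (mulCayley_adj_iff_of_symm h1 hS).mpr (by simpa using hs)⟩,
        Finset.mem_univ _, by simp⟩
    · congr 1; group

/-- The left side is the quadratic form `⟨1_F, T_S 1_F⟩`, and `‖1_F‖² = |F|`. -/
lemma sum_card_filter_mul_mem_le (F S : Finset Γ) [DecidableEq Γ] :
    ∑ x ∈ F, ((S.filter fun s => x * s ∈ F).card : ℝ) ≤ ‖L2.convOp S.toMonoidAlgebra‖ * F.card := by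
  have hfin : ∀ x ∉ F, ((F : Set Γ).indicator (1 : Γ → ℝ) x) ^ 2 = 0 := fun x hx => by simp [hx]
  set f : L2 Γ := ⟨(F : Set Γ).indicator 1,
    L2.memℓp_of_summable_sq (summable_of_ne_finset_zero hfin)⟩ with hf
  have hfx : ∀ x, f x = if x ∈ F then 1 else 0 := fun x => by
    change (F : Set Γ).indicator (1 : Γ → ℝ) x = _
    simp [indicator_apply]
  have hnorm : ‖f‖ ^ 2 = F.card := by
    rw [L2.norm_sq_eq_tsum, tsum_eq_sum (s := F) fun x hx => hfin x hx]
    simp +contextual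
  have hT : ∀ x, L2.convOp S.toMonoidAlgebra f x = (S.filter fun s => x * s ∈ F).card := by
    intro x
    rw [L2.convOp_toMonoidAlgebra, _root_.sum_apply, lp.coeFn_sum, Finset.sum_apply]
    simp [hfx]
  have hinner : inner ℝ f (L2.convOp S.toMonoidAlgebra f)
      = ∑ x ∈ F, ((S.filter fun s => x * s ∈ F).card : ℝ) := by
    rw [lp.inner_eq_tsum, tsum_eq_sum (s := F) fun x hx => by rw [hfx, if_neg hx]; simp]
    refine Finset.sum_congr rfl fun x hx => ?_
    rw [hT, hfx, if_pos hx]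
    simp
  rw [← hinner, ← hnorm]
  refine (real_inner_le_norm _ _).trans ?_
  calc ‖f‖ * ‖L2.convOp S.toMonoidAlgebra f‖
      ≤ ‖f‖ * (‖L2.convOp S.toMonoidAlgebra‖ * ‖f‖) := by
        gcongr; exact ContinuousLinearMap.le_opNorm _ _
    _ = _ := by ring

/-- Of the `|S||F|` pairs `(x, s)` in `F × S`, those with `x * s ∉ F` correspond to boundary edges,
and at most `‖T_S‖ |F|` stay inside. -/
lemma card_sub_norm_convOp_le_edgeCheeger (h1 : 1 ∉ S) (hS : ∀ s ∈ S, s⁻¹ ∈ S) :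
    S.card - ‖L2.convOp S.toMonoidAlgebra‖ ≤ (mulCayley (S : Set Γ)).edgeCheeger := by
  classical
  have : Nonempty {F : Finset Γ // F.Nonempty} := ⟨⟨{1}, by simp⟩⟩
  refine le_ciInf fun ⟨F, hF⟩ => ?_
  have hpos : (0 : ℝ) < F.card := by exact_mod_cast hF.card_pos
  rw [le_div_iff₀ hpos]
  set P : Finset (Γ × Γ) := (F ×ˢ S).filter fun q => q.1 * q.2 ∉ F with hP
  have hmemP : ∀ q, q ∈ P ↔ (q.1 ∈ F ∧ q.2 ∈ S) ∧ q.1 * q.2 ∉ F := fun q => by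
    rw [hP, Finset.mem_filter, Finset.mem_product]
  have himage : (mulCayley (S : Set Γ)).edgeBoundary F
      = (fun q : Γ × Γ => s(q.1, q.1 * q.2)) '' (P : Set (Γ × Γ)) := by
    ext e
    constructor
    · rintro ⟨x, hx, y, hy, hxy, rfl⟩
      refine ⟨(x, x⁻¹ * y), ?_, by simp⟩
      rw [Finset.mem_coe, hmemP]
      exact ⟨⟨hx, (mulCayley_adj_iff_of_symm h1 hS).mp hxy⟩, by simpa using hy⟩
    · rintro ⟨q, hq, rfl⟩
      rw [Finset.mem_coe, hmemP] at hq
      exact ⟨q.1, hq.1.1, q.1 * q.2, hq.2,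
        (mulCayley_adj_iff_of_symm h1 hS).mpr (by simpa using hq.1.2), rfl⟩
  have hinj : InjOn (fun q : Γ × Γ => s(q.1, q.1 * q.2)) (P : Set (Γ × Γ)) := by
    intro q hq r hr hqr
    rw [Finset.mem_coe, hmemP] at hq hr
    rcases Sym2.eq_iff.mp hqr with ⟨h, h'⟩ | ⟨h, h'⟩
    · refine Prod.ext h ?_
      rw [h] at h'
      exact mul_left_cancel h'
    · exact absurd (h ▸ hq.1.1) hr.2
  have hcard : ((mulCayley (S : Set Γ)).edgeBoundary F).ncard = P.card := by
    rw [himage, hinj.ncard_image, ncard_coe_finset]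
  have hsplit : (P.card : ℝ) + ∑ x ∈ F, ((S.filter fun s => x * s ∈ F).card : ℝ)
      = S.card * F.card := by
    have e1 : P.card = ∑ x ∈ F, (S.filter fun s => x * s ∉ F).card := by
      rw [hP, Finset.card_filter, Finset.sum_product]
      exact Finset.sum_congr rfl fun x _ => (Finset.card_filter _ _).symm
    rw [e1]
    push_cast
    rw [← Finset.sum_add_distrib]
    have e2 : ∀ x ∈ F, ((S.filter fun s => x * s ∉ F).card : ℝ)
        + ((S.filter fun s => x * s ∈ F).card : ℝ) = S.card := by
      intro x _
      have := Finset.card_filter_add_card_filter_not (s := S) fun s => x * s ∈ F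
      rw [← this]; push_cast; ring
    rw [Finset.sum_congr rfl e2, Finset.sum_const, nsmul_eq_mul, mul_comm]
  have hle := sum_card_filter_mul_mem_le F S
  change _ ≤ (((mulCayley (S : Set Γ)).edgeBoundary F).ncard : ℝ)
  rw [hcard]
  nlinarith

/-- There are at most `‖T_S‖^n` walks of length `n` from `u` to `v`, and none shorter than `N`; the
union bound is the tail of a geometric series. -/
lemma bondPerc_mulCayley_mem_cluster_le (h1 : 1 ∉ S) (hS : ∀ s ∈ S, s⁻¹ ∈ S) (p : unitInterval)
    (hp : (p : ℝ) * ‖L2.convOp S.toMonoidAlgebra‖ < 1) (u v : Γ) (N : ℕ)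
    (hN : ∀ n < N, (S.toMonoidAlgebra ^ n).coeff (u⁻¹ * v) = 0) :
    ((mulCayley (S : Set Γ)).bondPerc p).real {ω | v ∈ (mulCayley (S : Set Γ)).cluster ω u}
      ≤ ((p : ℝ) * ‖L2.convOp S.toMonoidAlgebra‖) ^ N
        * (1 - (p : ℝ) * ‖L2.convOp S.toMonoidAlgebra‖)⁻¹ := by
  classical
  have hfin := (mulCayley_boundedDegree h1 hS).finite_neighborSet
  let _ : (mulCayley (S : Set Γ)).LocallyFinite := fun v => (hfin v).fintype
  set c := ‖L2.convOp S.toMonoidAlgebra‖ with hc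
  have hp0 : (0 : ℝ) ≤ p := p.2.1
  have hr0 : 0 ≤ (p : ℝ) * c := mul_nonneg hp0 (norm_nonneg _)
  have hcoeff : ∀ n g, ((S.toMonoidAlgebra ^ n).coeff g : ℝ) ≤ c ^ n := by
    intro n g
    refine (L2.coeff_le_norm_convOp _ _).trans ?_
    rw [map_pow]
    rcases Nat.eq_zero_or_pos n with rfl | hn
    · rw [pow_zero, pow_zero]
      exact ContinuousLinearMap.norm_id_le
    · exact norm_pow_le' _ hn
  have hlen : ∀ w : (mulCayley (S : Set Γ)).Walk u v, N ≤ w.length := by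
    intro w
    by_contra! hlt
    have hle := card_finsetWalkLength_mulCayley_le h1 hS w.length u v
    rw [hN _ hlt, Nat.le_zero, Finset.card_eq_zero] at hle
    have : w ∈ (mulCayley (S : Set Γ)).finsetWalkLength w.length u v := by
      rw [mem_finsetWalkLength_iff]
    rw [hle] at this
    simp at this
  have hgeom := (summable_geometric_of_lt_one hr0 hp).mul_left (((p : ℝ) * c) ^ N)
  refine ENNReal.toReal_le_of_le_ofReal
    (mul_nonneg (pow_nonneg hr0 _) (inv_nonneg.mpr (by linarith))) ?_
  refine (bondPerc_mem_cluster_le p u v N hlen).trans ?_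
  rw [← tsum_geometric_of_lt_one hr0 hp, ← tsum_mul_left,
    ENNReal.ofReal_tsum_of_nonneg (fun n => by positivity) hgeom]
  refine ENNReal.tsum_le_tsum fun m => ENNReal.ofReal_le_ofReal ?_
  rw [← pow_add, add_comm N m, mul_pow]
  gcongr
  refine le_trans ?_ (hcoeff (m + N) (u⁻¹ * v))
  exact_mod_cast card_finsetWalkLength_mulCayley_le h1 hS (m + N) u v

lemma not_ae_uniqueInfiniteCluster_mulCayley [Countable Γ] [Infinite Γ] (h1 : 1 ∉ S)
    (hS : ∀ s ∈ S, s⁻¹ ∈ S) (p : unitInterval)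
    (hp : (p : ℝ) * ‖L2.convOp S.toMonoidAlgebra‖ < 1) :
    ¬ ∀ᵐ ω ∂((mulCayley (S : Set Γ)).bondPerc p),
      (mulCayley (S : Set Γ)).UniqueInfiniteCluster ω := by
  classical
  set r := (p : ℝ) * ‖L2.convOp S.toMonoidAlgebra‖ with hr
  have hr0 : 0 ≤ r := mul_nonneg p.2.1 (norm_nonneg _)
  refine not_ae_uniqueInfiniteCluster (mulCayley_boundedDegree h1 hS).finite_neighborSet
    (fun x y => ⟨mulCayleyLeft _ (y * x⁻¹), ?_⟩) p fun ε hε => ?_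
  · change y * x⁻¹ * x = y
    simp
  have hlim : Filter.Tendsto (fun N : ℕ => r ^ N * (1 - r)⁻¹) Filter.atTop (nhds 0) := by
    simpa using (tendsto_pow_atTop_nhds_zero_of_lt_one hr0 hp).mul_const (1 - r)⁻¹
  obtain ⟨N, hN⟩ := (hlim.eventually (gt_mem_nhds hε)).exists
  set K : Finset Γ := (Finset.range N).biUnion fun n => (S.toMonoidAlgebra ^ n).coeff.support with hK
  -- Since `Γ` is infinite and `K` finite, vertices can be picked greedily so that no two are joined
  -- by a walk of length less than `N`.
  obtain ⟨x, -, hx⟩ := exists_seq_of_forall_finset_exists (fun _ : Γ => True)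
    (fun x y => x⁻¹ * y ∉ K) (fun s _ => by
      obtain ⟨y, hy⟩ := Infinite.exists_notMem_finset (s.biUnion fun x => K.image fun k => x * k)
      refine ⟨y, trivial, fun x hx hc => hy ?_⟩
      rw [Finset.mem_biUnion]
      exact ⟨x, hx, Finset.mem_image.mpr ⟨_, hc, by simp⟩⟩)
  refine ⟨x, fun m n hmn => ?_⟩
  refine (bondPerc_mulCayley_mem_cluster_le h1 hS p hp (x m) (x n) N fun k hk => ?_).trans hN.le
  by_contra hne
  exact hx m n hmn (Finset.mem_biUnion.mpr
    ⟨k, Finset.mem_range.mpr hk, Finsupp.mem_support_iff.mpr hne⟩)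

lemma one_div_norm_convOp_le_pUnique [Countable Γ] [Infinite Γ] (h1 : 1 ∉ S)
    (hS : ∀ s ∈ S, s⁻¹ ∈ S) (hgen : Subgroup.closure (S : Set Γ) = ⊤)
    (hpos : 0 < ‖L2.convOp S.toMonoidAlgebra‖) :
    1 / ‖L2.convOp S.toMonoidAlgebra‖ ≤ (mulCayley (S : Set Γ)).pUnique := by
  -- The set must be nonempty, since `sInf ∅ = 0`; at `p = 1` the whole connected infinite graph is
  -- the only cluster.
  refine le_csInf ⟨1, ⟨zero_le_one, le_rfl⟩, ae_uniqueInfiniteCluster_one (mulCayley_connected hgen)⟩ ?_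
  rintro p ⟨hp, hae⟩
  by_contra! hlt
  rw [lt_div_iff₀ hpos] at hlt
  exact not_ae_uniqueInfiniteCluster_mulCayley h1 hS ⟨p, hp⟩ hlt hae

lemma pUnique_mulCayley_le_one [Countable Γ] [Infinite Γ]
    (hgen : Subgroup.closure (S : Set Γ) = ⊤) : (mulCayley (S : Set Γ)).pUnique ≤ 1 :=
  csInf_le ⟨0, fun _ hp => hp.1.1⟩
    ⟨⟨zero_le_one, le_rfl⟩, ae_uniqueInfiniteCluster_one (mulCayley_connected hgen)⟩

/-- In a finite graph the full vertex set has empty boundary. -/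
lemma infinite_of_edgeCheeger_pos {V : Type*} [Nonempty V] {G : SimpleGraph V}
    (hG : 0 < G.edgeCheeger) : Infinite V := by
  by_contra hfin
  rw [not_infinite_iff_finite] at hfin
  have := Fintype.ofFinite V
  have hle := G.edgeCheeger_mul_card_le Finset.univ
  have hempty : G.edgeBoundary ((Finset.univ : Finset V) : Set V) = ∅ := by
    ext e; simp [edgeBoundary]
  rw [hempty, ncard_empty, Nat.cast_zero] at hle
  have hpos : (0 : ℝ) < (Finset.univ : Finset V).card := by
    exact_mod_cast Finset.card_pos.mpr Finset.univ_nonempty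
  nlinarith

end SimpleGraph

end Cayley

/-! ### Analyticity at the uniqueness threshold -/

lemma Group.FG.countable (Γ : Type*) [Group Γ] [Group.FG Γ] : Countable Γ := by
  obtain ⟨S, hS⟩ := (Group.FG.out : (⊤ : Subgroup Γ).FG)
  have hsurj : Function.Surjective (FreeGroup.lift ((↑) : S → Γ)) := by
    rw [← MonoidHom.range_eq_top, FreeGroup.range_lift_eq_closure, Subtype.range_coe]
    exact hS
  exact hsurj.countable

theorem analyticWithinAt_percDensity_pUnique {Γ : Type*} [Group Γ] [Countable Γ] {S : Finset Γ}
    (hgen : Subgroup.closure (S : Set Γ) = ⊤) (hne : S.Nonempty) (h1 : 1 ∉ S)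
    (hS : ∀ s ∈ S, s⁻¹ ∈ S) (hnorm : 2 * ‖L2.convOp S.toMonoidAlgebra‖ ≤ S.card) (o : Γ) :
    AnalyticWithinAt ℝ ((SimpleGraph.mulCayley (S : Set Γ)).percDensity o) (Set.Icc 0 1)
      (SimpleGraph.mulCayley (S : Set Γ)).pUnique := by
  set c := ‖L2.convOp S.toMonoidAlgebra‖ with hc
  set h := (SimpleGraph.mulCayley (S : Set Γ)).edgeCheeger with hh
  have hcard : (1 : ℝ) ≤ S.card := by exact_mod_cast hne.card_pos
  have hch : S.card - c ≤ h := SimpleGraph.card_sub_norm_convOp_le_edgeCheeger h1 hS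
  have hh0 : 0 < h := by linarith
  have : Infinite Γ := SimpleGraph.infinite_of_edgeCheeger_pos hh0
  have hc0 : 0 < c := by
    obtain ⟨s, hs⟩ := hne
    have := L2.coeff_le_norm_convOp S.toMonoidAlgebra s
    rw [Finset.coeff_toMonoidAlgebra, if_pos hs, Nat.cast_one] at this
    exact one_pos.trans_le this
  -- From `h ≥ |S| - c` and `2c ≤ |S|` follows `h ≥ c`, so `1/(1+h) < 1/c ≤ p_u`.
  have hlt : 1 / (1 + h) < (SimpleGraph.mulCayley (S : Set Γ)).pUnique :=
    (one_div_lt_one_div_of_lt hc0 (by linarith)).trans_le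
      (SimpleGraph.one_div_norm_convOp_le_pUnique h1 hS hgen hc0)
  have hle := SimpleGraph.pUnique_mulCayley_le_one hgen
  -- Near `p_u > 1/(1+h)` the sets `(1/(1+h), 1]` and `[0, 1]` coincide, even if `p_u = 1`.
  refine (SimpleGraph.analyticOn_percDensity (SimpleGraph.mulCayley_boundedDegree h1 hS) hh0 o _
    ⟨hlt, hle⟩).mono_of_mem_nhdsWithin ?_
  filter_upwards [self_mem_nhdsWithin, mem_nhdsWithin_of_mem_nhds (lt_mem_nhds hlt)] with x hx hx'
  exact ⟨hx', hx.2⟩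

theorem mainTheorem5 :
    (∀ (V : Type*) [Countable V] [Infinite V] (G : SimpleGraph V),
      G.BoundedDegree → 0 < G.edgeCheeger → ∀ o : V,
        AnalyticOn ℝ (G.percDensity o) (Set.Ioc (1 / (1 + G.edgeCheeger)) 1) ∧
        G.pAnalytic o ≤ 1 / (1 + G.edgeCheeger)) ∧
    (∀ (Γ : Type*) [Group Γ] [Group.FG Γ], ¬ AmenableGroup Γ →
      ∃ S : Finset Γ, Subgroup.closure (S : Set Γ) = ⊤ ∧
        ∀ o : Γ, AnalyticWithinAt ℝ ((SimpleGraph.mulCayley (S : Set Γ)).percDensity o)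
          (Set.Icc 0 1) (SimpleGraph.mulCayley (S : Set Γ)).pUnique) := by
  refine ⟨fun V _ _ G hG hh o => ⟨SimpleGraph.analyticOn_percDensity hG hh o,
    SimpleGraph.pAnalytic_le hG hh o⟩, fun Γ _ _ hΓ => ?_⟩
  have := Group.FG.countable Γ
  obtain ⟨S, hgen, hne, h1, hS, hnorm⟩ := exists_generating_set_norm_convOp_le hΓ
  exact ⟨S, hgen, analyticWithinAt_percDensity_pUnique hgen hne h1 hS hnorm⟩
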